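/- All Hilbert spaces are complex and separable. A contractive analytic function $\{\mathcal E,\mathcal F,\Psi(z)\}$ is a map $\Psi:\mathbb D\to B(\mathcal E,\mathcal F)$ given by a power series $\Psi(z)=\sum_{n\ge 0}z^n\Psi_n$, $\Psi_n\in B(\mathcal E,\mathcal F)$, converging in the strong operator topology for every $z\in\mathbb D$, with $\sup_{z\in\mathbb D}\|\Psi(z)\|\le 1$; it is purely contractive if $\|\Psi(0)e\|<\|e\|$ for all $e\ne 0$. Its boundary values $\Psi(e^{it})=\text{SOT-}\lim_{r\to1^-}\Psi(re^{it})$ exist for almost every $t\in[0,2\pi]$, and $\Psi$ also denotes the multiplication operator $L^2(\mathcal E)\to L^2(\mathcal F)$, $(\Psi v)(t)=\Psi(e^{it})v(t)$. Put $\Delta_\Psi=(I-\Psi^*\Psi)^{1/2}$ on $L^2(\mathcal E)$. The Hardy space $H^2(\mathcal E)$ is regarded as a subspace of $L^2(\mathcal E)$. Let $k\ge 2$, let $\{\mathcal E_1,\mathcal E_{k+1},\Theta(z)\}$ be a purely contractive analytic function, and let $\{\mathcal E_i,\mathcal E_{i+1},\Theta_i(z)\}$, $i=1,\dots,k$, be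 contractive analytic functions with $$\Theta(z)=\Theta_k(z)\cdots\Theta_1(z)\qquad(z\in\mathbb D).$$ Write $\Delta_i=\Delta_{\Theta_i}$ and let $$Z_k:\overline{\Delta_\Theta L^2(\mathcal E_1)}\to\overline{\Delta_kL^2(\mathcal E_k)}\oplus\cdots\oplus\overline{\Delta_1L^2(\mathcal E_1)}$$ be the isometry determined by $Z_k(\Delta_\Theta f)=\Delta_k\Theta_{k-1}\cdots\Theta_1f\oplus\cdots\oplus\Delta_2\Theta_1f\oplus\Delta_1f$ for $f\in L^2(\mathcal E_1)$. Suppose that the factorization is $k$-regular, that is, that $Z_k$ is unitary. For $i=1,\dots,k-1$ let $\mathcal M_i\subseteq L^2(\mathcal E_{k+1})\oplus\overline{\Delta_\Theta L^2(\mathcal E_1)}$ be the subspace $$\begin{aligned}\mathcal M_i=\Big\{&\Theta_k\cdots\Theta_{i+1}u\oplus Z_k^*\big(\Delta_k\Theta_{k-1}\cdots\Theta_{i+1}u\oplus\cdots\oplus\Delta_{i+1}u\oplus v_i\oplus\cdots\oplus v_1\big):\\&u\in H^2(\mathcal E_{i+1}),\ v_j\in\overline{\Delta_jL^2(\mathcal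 E_j)},\ 1\le j\le i\Big\}\ominus\big\{\Theta u\oplus\Delta_\Theta u:u\in H^2(\mathcal E_1)\big\}.\end{aligned}$$ (These are the invariant subspaces, associated with the factorization, of the Sz.-Nagy--Foiaş model operator of $\Theta$.) Then, for each $i=1,\dots,k-2$, $\mathcal M_i=\mathcal M_{i+1}$ if and only if $\Theta_{i+1}$ is a unitary constant, that is, there exists a unitary operator $U:\mathcal E_{i+1}\to\mathcal E_{i+2}$ such that $\Theta_{i+1}(z)=U$ for all $z\in\mathbb D$. -/

import Mathlib

open MeasureTheory Filter Topology
open scoped ENNReal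

namespace KRegular

/-! ## Products of operators along a chain of spaces -/

section Chain

/-- For a chain of operators `T j : X j → X (j + 1)`, `j = 0, …, k - 1`, the product
`T (j - 1) ∘ ⋯ ∘ T i : X i → X j` for `i ≤ j` (the identity if `i = j`). -/
noncomputable def chainProd {k : ℕ} {X : Fin (k + 1) → Type*} [∀ i, NormedAddCommGroup (X i)]
    [∀ i, NormedSpace ℂ (X i)] (T : ∀ j : Fin k, X j.castSucc →L[ℂ] X j.succ)
    (i j : Fin (k + 1)) (h : i ≤ j) : X i →L[ℂ] X j :=
  Nat.leRec (n := i.1) (motive := fun n _ => (hn : n < k + 1) → (X i →L[ℂ] X ⟨n, hn⟩))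
    (fun _ => ContinuousLinearMap.id ℂ (X i))
    (fun n _ P hn => (T ⟨n, Nat.lt_of_succ_lt_succ hn⟩).comp (P (Nat.lt_of_succ_lt hn)))
    (Fin.le_def.mp h) j.2

theorem chainProd_self {k : ℕ} {X : Fin (k + 1) → Type*} [∀ i, NormedAddCommGroup (X i)]
    [∀ i, NormedSpace ℂ (X i)] (T : ∀ j : Fin k, X j.castSucc →L[ℂ] X j.succ)
    (i : Fin (k + 1)) : chainProd T i i le_rfl = ContinuousLinearMap.id ℂ (X i) := by
  unfold chainProd
  rw [Nat.leRec_self]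

theorem chainProd_succ {k : ℕ} {X : Fin (k + 1) → Type*} [∀ i, NormedAddCommGroup (X i)]
    [∀ i, NormedSpace ℂ (X i)] (T : ∀ j : Fin k, X j.castSucc →L[ℂ] X j.succ)
    (i : Fin (k + 1)) (j : Fin k) (h : i ≤ j.castSucc) :
    chainProd T i j.succ (h.trans (Fin.castSucc_lt_succ).le)
      = (T j).comp (chainProd T i j.castSucc h) := by
  unfold chainProd
  exact congrFun (Nat.leRec_succ (n := i.1)
    (motive := fun n _ => (hn : n < k + 1) → (X i →L[ℂ] X ⟨n, hn⟩)) _ _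
      (Fin.le_def.mp h)) j.succ.2

end Chain

/-! ## Defect operators and `k`-regular factorizations of contractions -/

section Operators

variable {H K : Type*} [NormedAddCommGroup H] [InnerProductSpace ℂ H] [CompleteSpace H]
  [NormedAddCommGroup K] [InnerProductSpace ℂ K] [CompleteSpace K]

/-- The defect operator `D_A = (I - A^* A)^{1/2}` of a contraction `A`. -/
noncomputable def defect (A : H →L[ℂ] K) : H →L[ℂ] H :=
  CFC.sqrt (1 - (ContinuousLinearMap.adjoint A).comp A)

/-- The defect space: the closure of the range of the defect operator. -/
noncomputable def defectSpace (A : H →L[ℂ] K) : Submodule ℂ H :=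
  (LinearMap.range (defect A).toLinearMap).topologicalClosure

noncomputable instance (A : H →L[ℂ] K) : CompleteSpace (defectSpace A) := by
  unfold defectSpace; infer_instance

/-- The defect operator, regarded as a map into the defect space. -/
noncomputable def defectTo (A : H →L[ℂ] K) : H →L[ℂ] defectSpace A :=
  (defect A).codRestrict (defectSpace A)
    (fun x => Submodule.le_topologicalClosure _ (LinearMap.mem_range_self _ x))

theorem norm_defect_sq (A : H →L[ℂ] K) (hA : ‖A‖ ≤ 1) (x : H) :
    ‖defect A x‖ ^ 2 = ‖x‖ ^ 2 - ‖A x‖ ^ 2 := by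
  set B : H →L[ℂ] H := 1 - (ContinuousLinearMap.adjoint A).comp A with hB
  have hre : ∀ y, (inner ℂ (B y) y).re = ‖y‖ ^ 2 - ‖A y‖ ^ 2 := by
    intro y
    simp only [hB, sub_apply, one_apply_eq_self,
      ContinuousLinearMap.comp_apply, inner_sub_left, ContinuousLinearMap.adjoint_inner_left,
      inner_self_eq_norm_sq_to_K, Complex.sub_re]
    norm_cast
  have hpos : 0 ≤ B := by
    rw [ContinuousLinearMap.nonneg_iff_isPositive]
    have h1 : IsSelfAdjoint B :=
      (IsSelfAdjoint.one _).sub (ContinuousLinearMap.isPositive_adjoint_comp_self A).isSelfAdjoint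
    refine ContinuousLinearMap.isPositive_def'.mpr ⟨h1, fun y => ?_⟩
    have h2 : ‖A y‖ ≤ ‖y‖ := by simpa using A.le_of_opNorm_le hA y
    have h3 := pow_le_pow_left₀ (norm_nonneg _) h2 2
    rw [ContinuousLinearMap.reApplyInnerSelf_apply]
    exact (sub_nonneg.mpr h3).trans_eq (hre y).symm
  have hsa : IsSelfAdjoint (CFC.sqrt B) := (CFC.sqrt_nonneg B).isSelfAdjoint
  have h1 : inner ℂ (defect A x) (defect A x) = inner ℂ (B x) x := by
    have h2 : CFC.sqrt B * CFC.sqrt B = B := CFC.sqrt_mul_sqrt_self B hpos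
    conv_rhs => rw [← h2]
    change inner ℂ (CFC.sqrt B x) (CFC.sqrt B x) = inner ℂ (CFC.sqrt B (CFC.sqrt B x)) x
    exact (hsa.isSymmetric (CFC.sqrt B x) x).symm
  have h3 := hre x
  rw [← h1, inner_self_eq_norm_sq_to_K] at h3
  rw [← h3]
  norm_cast

theorem denseRange_defectTo (A : H →L[ℂ] K) : DenseRange (defectTo A) := by
  intro y
  have hy : (y : H) ∈ closure (Set.range (defect A)) := y.2
  rw [closure_subtype]
  convert hy using 2
  ext z
  constructor
  · rintro ⟨_, ⟨x, rfl⟩, rfl⟩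
    exact ⟨x, rfl⟩
  · rintro ⟨x, rfl⟩
    exact ⟨_, ⟨x, rfl⟩, rfl⟩

variable {k : ℕ} {X : Fin (k + 1) → Type*} [∀ i, NormedAddCommGroup (X i)]
  [∀ i, InnerProductSpace ℂ (X i)] [∀ i, CompleteSpace (X i)]

/-- The Hilbert space direct sum of the defect spaces of the operators of a chain. -/
abbrev DefectSum (T : ∀ j : Fin k, X j.castSucc →L[ℂ] X j.succ) : Type _ :=
  PiLp 2 (fun j : Fin k => defectSpace (T j))

/-- The map `h ↦ ⨁_j D_{T_j} T_{j-1} ⋯ T_0 h` into the direct sum of the defect spaces. -/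
noncomputable def defectTuple (T : ∀ j : Fin k, X j.castSucc →L[ℂ] X j.succ) :
    X 0 →L[ℂ] DefectSum T :=
  (PiLp.continuousLinearEquiv 2 ℂ (fun j : Fin k => defectSpace (T j))).symm.toContinuousLinearMap.comp
    (ContinuousLinearMap.pi fun j =>
      (defectTo (T j)).comp (chainProd T 0 j.castSucc (Fin.zero_le _)))

/-- For a factorization `A = T_{k-1} ⋯ T_0` of a contraction into contractions, the isometry `Z`
from the defect space of `A` into the direct sum of the defect spaces of the `T_j`: the continuous
extension of `D_A h ↦ ⨁_j D_{T_j} T_{j-1} ⋯ T_0 h` (see `canonicalZ_defectTo`). -/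
noncomputable def canonicalZ (A : X 0 →L[ℂ] X (Fin.last k))
    (T : ∀ j : Fin k, X j.castSucc →L[ℂ] X j.succ) : defectSpace A →L[ℂ] DefectSum T :=
  LinearMap.extendOfNorm (defectTuple T).toLinearMap (defectTo A).toLinearMap

theorem norm_defectTuple (A : X 0 →L[ℂ] X (Fin.last k))
    (T : ∀ j : Fin k, X j.castSucc →L[ℂ] X j.succ) (hT : ∀ j, ‖T j‖ ≤ 1)
    (hA : A = chainProd T 0 (Fin.last k) (Fin.zero_le _)) (h : X 0) :
    ‖defectTuple T h‖ = ‖defectTo A h‖ := by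
  have hn : ∀ i j (hij : i ≤ j), ‖chainProd T i j hij‖ ≤ 1 := by
    intro i j
    induction j using Fin.induction with
    | zero =>
      intro hij
      obtain rfl : i = 0 := Fin.le_zero_iff.mp hij
      rw [chainProd_self]
      exact ContinuousLinearMap.norm_id_le
    | succ j ih =>
      intro hij
      rcases hij.eq_or_lt with rfl | hlt
      · rw [chainProd_self]
        exact ContinuousLinearMap.norm_id_le
      · have hle : i ≤ j.castSucc := Fin.le_castSucc_iff.mpr hlt
        rw [chainProd_succ T i j hle]
        exact (ContinuousLinearMap.opNorm_comp_le _ _).trans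
          (mul_le_one₀ (hT j) (norm_nonneg _) (ih hle))
  have key : ∀ j : Fin k, ‖defectTuple T h j‖ ^ 2
      = ‖chainProd T 0 j.castSucc (Fin.zero_le _) h‖ ^ 2
        - ‖chainProd T 0 j.succ (Fin.zero_le _) h‖ ^ 2 := by
    intro j
    rw [chainProd_succ T 0 j (Fin.zero_le _)]
    exact norm_defect_sq (T j) (hT j) _
  have htel : ∀ f : Fin (k + 1) → ℝ,
      ∑ j : Fin k, (f j.castSucc - f j.succ) = f 0 - f (Fin.last k) := by
    intro f
    have h1 := Fin.sum_univ_succ f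
    have h2 := Fin.sum_univ_castSucc f
    rw [Finset.sum_sub_distrib]
    linarith
  have hA1 : ‖A‖ ≤ 1 := hA ▸ hn _ _ _
  have h1 : ‖defectTuple T h‖ ^ 2 = ‖defectTo A h‖ ^ 2 := by
    rw [PiLp.norm_sq_eq_of_L2, Finset.sum_congr rfl fun j _ => key j,
      htel (fun j => ‖chainProd T 0 j (Fin.zero_le _) h‖ ^ 2), chainProd_self, ← hA]
    exact (norm_defect_sq A hA1 h).symm
  exact (sq_eq_sq₀ (norm_nonneg _) (norm_nonneg _)).mp h1

theorem canonicalZ_defectTo (A : X 0 →L[ℂ] X (Fin.last k))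
    (T : ∀ j : Fin k, X j.castSucc →L[ℂ] X j.succ) (hT : ∀ j, ‖T j‖ ≤ 1)
    (hA : A = chainProd T 0 (Fin.last k) (Fin.zero_le _)) (h : X 0) :
    canonicalZ A T (defectTo A h) = defectTuple T h :=
  LinearMap.extendOfNorm_eq (denseRange_defectTo A)
    ⟨1, fun x => by simpa using (norm_defectTuple A T hT hA x).le⟩ h

/-- `Z` is a unitary operator: an isometry onto the direct sum of the defect spaces. -/
def IsUnitaryMap (Z : H →L[ℂ] K) : Prop :=
  (∀ x, ‖Z x‖ = ‖x‖) ∧ Function.Surjective Z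

end Operators

/-! ## Contractive analytic functions and their boundary values -/

section Analytic

/-- A contractive analytic function on the open unit disc with values in `B(E, F)`: it is given by
a strongly convergent power series and bounded by one in norm. Only the values on the disc
matter. -/
structure ContractiveAnalytic (E F : Type*) [NormedAddCommGroup E] [InnerProductSpace ℂ E]
    [NormedAddCommGroup F] [InnerProductSpace ℂ F] where
  toFun : ℂ → (E →L[ℂ] F)
  powerSeries : ∃ c : ℕ → (E →L[ℂ] F), ∀ z ∈ Metric.ball (0 : ℂ) 1, ∀ e : E,
    HasSum (fun n => z ^ n • c n e) (toFun z e)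
  contractive : ∀ z ∈ Metric.ball (0 : ℂ) 1, ‖toFun z‖ ≤ 1

variable {E F : Type*} [NormedAddCommGroup E] [InnerProductSpace ℂ E]
  [NormedAddCommGroup F] [InnerProductSpace ℂ F]

/-- `‖Θ(0) e‖ < ‖e‖` for all `e ≠ 0`. -/
def ContractiveAnalytic.IsPure (Θ : ContractiveAnalytic E F) : Prop :=
  ∀ e : E, e ≠ 0 → ‖Θ.toFun 0 e‖ < ‖e‖

/-- `Θ(z) = U` on the disc, for some unitary operator `U : E → F`. -/
def ContractiveAnalytic.IsUnitaryConstant (Θ : ContractiveAnalytic E F) : Prop :=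
  ∃ U : E ≃ₗᵢ[ℂ] F, ∀ z ∈ Metric.ball (0 : ℂ) 1, ∀ e : E, Θ.toFun z e = U e

instance factTwoPiPos : Fact (0 < 2 * Real.pi) := ⟨Real.two_pi_pos⟩

/-- `[0, 2π]` with its end points identified. -/
abbrev Torus : Type := AddCircle (2 * Real.pi)

/-- `L²(E)` with respect to normalized Lebesgue measure `dt / 2π`. -/
abbrev LTwo (E : Type*) [NormedAddCommGroup E] : Type _ :=
  Lp E 2 (AddCircle.haarAddCircle : Measure Torus)

/-- `A` is the radial limit of `Θ` at `e^{it}` in the strong operator topology. -/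
def ContractiveAnalytic.HasBoundaryValue (Θ : ContractiveAnalytic E F) (t : Torus)
    (A : E →L[ℂ] F) : Prop :=
  ∀ e : E, Tendsto (fun r : ℝ => Θ.toFun ((r : ℂ) * (AddCircle.toCircle t : ℂ)) e)
    (𝓝[<] 1) (𝓝 (A e))

open Classical in
/-- The boundary value `Θ(e^{it})`; it exists for almost every `t` when `E` and `F` are
separable. -/
noncomputable def ContractiveAnalytic.boundary (Θ : ContractiveAnalytic E F) (t : Torus) :
    E →L[ℂ] F :=
  if h : ∃ A, Θ.HasBoundaryValue t A then h.choose else 0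

/-- `M` is the operator of multiplication `(M v)(t) = Θ(e^{it}) v(t)` from `L²(E)` to `L²(F)`. -/
def ContractiveAnalytic.IsMulOp (Θ : ContractiveAnalytic E F) (M : LTwo E →L[ℂ] LTwo F) : Prop :=
  ∀ v : LTwo E, ∀ᵐ t ∂(AddCircle.haarAddCircle : Measure Torus), M v t = Θ.boundary t (v t)

theorem ContractiveAnalytic.IsMulOp.unique {Θ : ContractiveAnalytic E F}
    {M N : LTwo E →L[ℂ] LTwo F} (hM : Θ.IsMulOp M) (hN : Θ.IsMulOp N) : M = N := by
  ext1 v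
  refine Lp.ext ?_
  filter_upwards [hM v, hN v] with t h1 h2
  rw [h1, h2]

open Classical in
/-- The operator `Θ : L²(E) → L²(F)` of multiplication by the boundary values of `Θ`. It is
unique, and it exists when `E` and `F` are separable Hilbert spaces. -/
noncomputable def ContractiveAnalytic.mulOp (Θ : ContractiveAnalytic E F) :
    LTwo E →L[ℂ] LTwo F :=
  if h : ∃ M, Θ.IsMulOp M then h.choose else 0

variable (E) in
/-- The Hardy space `H²(E)`, as the space of all functions in `L²(E)` whose Fourier coefficients
of negative index vanish. -/
noncomputable def hardy : Submodule ℂ (LTwo E) where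
  carrier := {f | ∀ n : ℤ, n < 0 → fourierCoeff (f : Torus → E) n = 0}
  zero_mem' := by
    intro n _
    rw [fourierCoeff_congr_ae (Lp.coeFn_zero E 2 _)]
    simp [fourierCoeff]
  add_mem' := by
    intro f g hf hg n hn
    rw [fourierCoeff_congr_ae (Lp.coeFn_add f g), fourierCoeff.add
      ((Lp.memLp f).integrable (by norm_num)) ((Lp.memLp g).integrable (by norm_num)),
      Pi.add_apply, hf n hn, hg n hn, add_zero]
  smul_mem' := by
    intro c f hf n hn
    rw [fourierCoeff_congr_ae (Lp.coeFn_smul c f), fourierCoeff.const_smul, hf n hn, smul_zero]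

end Analytic

/-! ## Regular factorizations of analytic functions and the associated subspaces -/

section Model

variable {k : ℕ} {E : Fin (k + 1) → Type*} [∀ i, NormedAddCommGroup (E i)]
  [∀ i, InnerProductSpace ℂ (E i)] [∀ i, CompleteSpace (E i)]

/-- The multiplication operators of the factors, as a chain of operators between `L²` spaces. -/
noncomputable def mulOps (Φ : ∀ j : Fin k, ContractiveAnalytic (E j.castSucc) (E j.succ))
    (j : Fin k) : LTwo (E j.castSucc) →L[ℂ] LTwo (E j.succ) :=
  (Φ j).mulOp

/-- The product `Φ_{j-1} ⋯ Φ_i : L²(E_i) → L²(E_j)` of multiplication operators, `i ≤ j`. -/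
noncomputable def mulProd (Φ : ∀ j : Fin k, ContractiveAnalytic (E j.castSucc) (E j.succ))
    (i j : Fin (k + 1)) (h : i ≤ j) : LTwo (E i) →L[ℂ] LTwo (E j) :=
  chainProd (X := fun i => LTwo (E i)) (mulOps Φ) i j h

/-- The isometry `Z` attached to the factorization `Θ = Φ_{k-1} ⋯ Φ_0`: the continuous extension
of `Δ_Θ f ↦ ⨁_j Δ_{Φ_j} Φ_{j-1} ⋯ Φ_0 f`. -/
noncomputable def factorZ (Θ : ContractiveAnalytic (E 0) (E (Fin.last k)))
    (Φ : ∀ j : Fin k, ContractiveAnalytic (E j.castSucc) (E j.succ)) :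
    defectSpace Θ.mulOp →L[ℂ] DefectSum (X := fun i => LTwo (E i)) (mulOps Φ) :=
  canonicalZ (X := fun i => LTwo (E i)) Θ.mulOp (mulOps Φ)

/-- `Θ(z) = Φ_{k-1}(z) ⋯ Φ_0(z)` on the disc, and this factorization is `k`-regular. -/
def IsRegularFactorization (Θ : ContractiveAnalytic (E 0) (E (Fin.last k)))
    (Φ : ∀ j : Fin k, ContractiveAnalytic (E j.castSucc) (E j.succ)) : Prop :=
  (∀ z ∈ Metric.ball (0 : ℂ) 1,
    Θ.toFun z = chainProd (fun j => (Φ j).toFun z) 0 (Fin.last k) (Fin.zero_le _)) ∧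
  IsUnitaryMap (factorZ Θ Φ)

/-- The space `L²(E_*) ⊕ closure (Δ_Θ L²(E))`, which contains the model space
`H(Θ) = [H²(E_*) ⊕ closure (Δ_Θ L²(E))] ⊖ {Θ u ⊕ Δ_Θ u : u ∈ H²(E)}`. -/
abbrev ModelAmbient {E F : Type*} [NormedAddCommGroup E] [InnerProductSpace ℂ E] [CompleteSpace E]
    [NormedAddCommGroup F] [InnerProductSpace ℂ F] [CompleteSpace F]
    (Θ : ContractiveAnalytic E F) : Type _ :=
  WithLp 2 (LTwo F × defectSpace Θ.mulOp)

/-- The subspace `{Θ u ⊕ Δ_Θ u : u ∈ H²(E)}`. -/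
noncomputable def graphSpace {E F : Type*} [NormedAddCommGroup E] [InnerProductSpace ℂ E]
    [CompleteSpace E] [NormedAddCommGroup F] [InnerProductSpace ℂ F] [CompleteSpace F]
    (Θ : ContractiveAnalytic E F) : Submodule ℂ (ModelAmbient Θ) where
  carrier := {x | ∃ u ∈ hardy E, x = WithLp.toLp 2 (Θ.mulOp u, defectTo Θ.mulOp u)}
  zero_mem' := ⟨0, zero_mem _, by simp only [map_zero]; rfl⟩
  add_mem' := by
    rintro _ _ ⟨u, hu, rfl⟩ ⟨v, hv, rfl⟩
    exact ⟨u + v, add_mem hu hv, by simp [← WithLp.toLp_add]⟩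
  smul_mem' := by
    rintro c _ ⟨u, hu, rfl⟩
    exact ⟨c • u, Submodule.smul_mem _ c hu, by simp [← WithLp.toLp_smul]⟩

/-- The subspace of all vectors
`Φ_{k-1} ⋯ Φ_i u ⊕ Z^* (Δ_{k-1} Φ_{k-2} ⋯ Φ_i u ⊕ ⋯ ⊕ Δ_i u ⊕ v_{i-1} ⊕ ⋯ ⊕ v_0)`
with `u ∈ H²(E_i)` and `v_j` in the defect space of `Φ_j` for `j < i`. -/
noncomputable def preSubspace (Θ : ContractiveAnalytic (E 0) (E (Fin.last k)))
    (Φ : ∀ j : Fin k, ContractiveAnalytic (E j.castSucc) (E j.succ)) (i : Fin (k + 1)) :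
    Submodule ℂ (ModelAmbient Θ) where
  carrier := {x | ∃ u ∈ hardy (E i), ∃ w : DefectSum (X := fun i => LTwo (E i)) (mulOps Φ),
    (∀ (j : Fin k) (h : i ≤ j.castSucc),
      w j = defectTo (mulOps Φ j) (mulProd Φ i j.castSucc h u)) ∧
    x = WithLp.toLp 2 (mulProd Φ i (Fin.last k) (Fin.le_last i) u,
      ContinuousLinearMap.adjoint (factorZ Θ Φ) w)}
  zero_mem' := ⟨0, zero_mem _, 0, by simp, by simp only [map_zero]; rfl⟩
  add_mem' := by
    rintro _ _ ⟨u, hu, w, hw, rfl⟩ ⟨u', hu', w', hw', rfl⟩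
    exact ⟨u + u', add_mem hu hu', w + w', fun j h => by simp [hw j h, hw' j h],
      by simp [← WithLp.toLp_add]⟩
  smul_mem' := by
    rintro c _ ⟨u, hu, w, hw, rfl⟩
    exact ⟨c • u, Submodule.smul_mem _ c hu, c • w, fun j h => by simp [hw j h],
      by simp [← WithLp.toLp_smul]⟩

/-- The invariant subspace `M_i` of the model operator on `H(Θ)` that corresponds to the
factorization `Θ = Φ_{k-1} ⋯ Φ_0`: the orthogonal complement of `{Θ u ⊕ Δ_Θ u : u ∈ H²(E)}` in
the subspace `preSubspace Θ Φ i`. -/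
noncomputable def invSubspace (Θ : ContractiveAnalytic (E 0) (E (Fin.last k)))
    (Φ : ∀ j : Fin k, ContractiveAnalytic (E j.castSucc) (E j.succ)) (i : Fin (k + 1)) :
    Submodule ℂ (ModelAmbient Θ) :=
  preSubspace Θ Φ i ⊓ (graphSpace Θ)ᗮ

end Model

end KRegular

/-! Number the factors from 0, so that Φ_i maps E_i to E_{i+1}. Let G = {Θu ⊕ Δ_Θ u : u ∈ H²} and
let S_i be the space `preSubspace` of which M_i is the part orthogonal to G. G is complete and lies
in every S_i, and S_i ⊆ S_{i+1}; hence M_i = M_{i+1} exactly when S_{i+1} ⊆ S_i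
(`IsRegularFactorization.invSubspace_eq_iff`). Vectors of S_{i+1} carry a free component v_i where
those of S_i carry Δ_i u. As Z is unitary, Z^* is injective, and u is recovered from its final image
and its defect components because ‖Tu‖² + ‖D_T u‖² = ‖u‖². So the inclusion says that u ↦ Φ_i u ⊕
Δ_i u maps H²(E_i) onto H²(E_{i+1}) ⊕ closure(Δ_i L²): this is `HardySurjective`.

For a single function Θ this property characterizes unitary constants. If u ∈ H² is sent to 0 ⊕ Δf,
then Δ(u - f) = 0, so Θ^*Θ(u - f) = u - f, and Θu = 0 gives (I - Θ^*Θ)f = u ∈ H². Since I - Θ^*Θ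
commutes with every e^{int}, its range lies in the intersection of all e^{int}H², which is 0. Thus Θ
is isometric on L² and maps H²(E) onto H²(F); it therefore carries H² ⊖ e^{it}H², the constants,
onto the constants. Conversely, a unitary constant has no defect, and its inverse preserves H².

The analytic groundwork is the vector-valued Fatou theorem, obtained from Poisson integrals at
Lebesgue points. It shows that boundary values exist almost everywhere, so that `boundary` and
`mulOp` are the intended objects and are multiplicative along the chain. -/

namespace KRegular

/-! ### Fourier analysis in L²(F) and H²(F). -/

section Monomials

open AddCircle

variable {F : Type*} [NormedAddCommGroup F] [InnerProductSpace ℂ F]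

theorem norm_fourier_apply (n : ℤ) (t : Torus) : ‖fourier n t‖ = 1 := by
  rw [fourier_apply]
  exact Circle.norm_coe _

theorem memLp_fourier_smul (n : ℤ) {f : Torus → F} (hf : MemLp f 2 haarAddCircle) :
    MemLp (fun t => fourier n t • f t) 2 (haarAddCircle : Measure Torus) := by
  refine hf.of_le ((fourier n).continuous.aestronglyMeasurable.smul hf.aestronglyMeasurable) ?_
  refine Eventually.of_forall fun t => ?_
  rw [norm_smul, norm_fourier_apply, one_mul]

/-- Multiplication by `e^{int}` on `L²(F)`. -/
noncomputable def fourierMul (n : ℤ) : LTwo F →ₗᵢ[ℂ] LTwo F where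
  toFun f := (memLp_fourier_smul n (Lp.memLp f)).toLp _
  map_add' f g := by
    rw [← MemLp.toLp_add]
    refine MemLp.toLp_congr _ _ ?_
    filter_upwards [Lp.coeFn_add f g] with t ht
    rw [ht, Pi.add_apply, smul_add]
    rfl
  map_smul' c f := by
    rw [RingHom.id_apply, ← MemLp.toLp_const_smul]
    refine MemLp.toLp_congr _ _ ?_
    filter_upwards [Lp.coeFn_smul c f] with t ht
    rw [ht, Pi.smul_apply, Pi.smul_apply, smul_comm]
  norm_map' f := by
    change ‖(memLp_fourier_smul n (Lp.memLp f)).toLp _‖ = _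
    rw [Lp.norm_toLp, Lp.norm_def]
    congr 1
    refine eLpNorm_congr_norm_ae (Eventually.of_forall fun t => ?_)
    rw [norm_smul, norm_fourier_apply, one_mul]

theorem coeFn_fourierMul (n : ℤ) (f : LTwo F) :
    fourierMul n f =ᵐ[haarAddCircle] fun t => fourier n t • f t :=
  (memLp_fourier_smul n (Lp.memLp f)).coeFn_toLp

theorem fourierMul_fourierMul (m n : ℤ) (f : LTwo F) :
    fourierMul m (fourierMul n f) = fourierMul (m + n) f := by
  refine Lp.ext ?_
  filter_upwards [coeFn_fourierMul m (fourierMul n f), coeFn_fourierMul n f,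
    coeFn_fourierMul (m + n) f] with t h1 h2 h3
  rw [h1, h2, h3, smul_smul, fourier_add]

theorem fourierMul_zero (f : LTwo F) : fourierMul 0 f = f := by
  refine Lp.ext ?_
  filter_upwards [coeFn_fourierMul 0 f] with t h1
  rw [h1, fourier_zero, one_smul]

/-- The function `t ↦ e^{int} y` in `L²(F)`. -/
noncomputable def monomial (n : ℤ) (y : F) : LTwo F :=
  fourierMul n (Lp.const 2 haarAddCircle y)

theorem coeFn_monomial (n : ℤ) (y : F) :
    monomial n y =ᵐ[haarAddCircle] fun t => fourier n t • y := by
  filter_upwards [coeFn_fourierMul n (Lp.const 2 haarAddCircle y),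
    Lp.coeFn_const (p := 2) (μ := (haarAddCircle : Measure Torus)) y] with t h1 h2
  unfold monomial
  rw [h1, h2, Function.const_apply]

theorem fourierMul_monomial (m n : ℤ) (y : F) :
    fourierMul m (monomial n y) = monomial (m + n) y :=
  fourierMul_fourierMul m n _

theorem fourierCoeff_fourierMul (m n : ℤ) (f : LTwo F) :
    fourierCoeff (fourierMul m f : Torus → F) n = fourierCoeff (f : Torus → F) (n - m) := by
  unfold fourierCoeff
  refine integral_congr_ae ?_
  filter_upwards [coeFn_fourierMul m f] with t h1
  rw [h1, smul_smul, ← fourier_add]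
  congr 3
  ring

theorem fourierCoeff_monomial [CompleteSpace F] (m n : ℤ) (y : F) :
    fourierCoeff (monomial m y : Torus → F) n = if m = n then y else 0 := by
  have h1 : fourierCoeff (monomial m y : Torus → F) n
      = (fourierCoeff (fourier m : Torus → ℂ) n) • y := by
    unfold fourierCoeff
    rw [← integral_smul_const]
    refine integral_congr_ae ?_
    filter_upwards [coeFn_monomial m y] with t h1
    rw [h1, smul_assoc]
  rw [h1, fourierCoeff_fourier, Pi.single_apply]
  by_cases h : m = n <;> simp [h, eq_comm]

/-- This exhibits the n-th Fourier coefficient as the adjoint of `monomialIsometry n`, which turns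
questions about coefficients into orthogonality relations. -/
theorem inner_monomial_left [CompleteSpace F] (n : ℤ) (y : F) (f : LTwo F) :
    inner ℂ (monomial n y) f = inner ℂ y (fourierCoeff (f : Torus → F) n) := by
  rw [L2.inner_def, fourierCoeff, ← integral_inner]
  · refine integral_congr_ae ?_
    filter_upwards [coeFn_monomial n y] with t h1
    rw [h1, inner_smul_left, inner_smul_right, fourier_neg]
  · exact ((Lp.memLp f).integrable (by norm_num)).fourier_smul _

/-- `y ↦ e^{int} y` as an isometry from `F` to `L²(F)`. -/
noncomputable def monomialIsometry (n : ℤ) : F →ₗᵢ[ℂ] LTwo F :=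
  (fourierMul n).comp
    { toLinearMap := Lp.constₗ 2 haarAddCircle ℂ
      norm_map' := fun y => by
        change ‖Lp.const 2 haarAddCircle y‖ = ‖y‖
        rw [Lp.norm_const' _ _ _ (by norm_num) (by norm_num)]
        simp }

theorem monomialIsometry_apply (n : ℤ) (y : F) : monomialIsometry n y = monomial n y := rfl

theorem norm_monomial (n : ℤ) (y : F) : ‖monomial n y‖ = ‖y‖ :=
  (monomialIsometry n).norm_map y

theorem orthogonalFamily_monomial [CompleteSpace F] :
    OrthogonalFamily ℂ (fun _ : ℤ => F) (monomialIsometry (F := F)) := by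
  intro m n hmn x y
  change inner ℂ (monomial m x) (monomial n y) = 0
  rw [inner_monomial_left, fourierCoeff_monomial, if_neg (Ne.symm hmn), inner_zero_right]

/-- Pairing with a fixed vector y reduces to completeness of the scalar Fourier basis. Separability
of F then merges the null sets belonging to the various y. -/
theorem eq_zero_of_fourierCoeff_eq_zero [CompleteSpace F] [TopologicalSpace.SeparableSpace F]
    (f : LTwo F) (hf : ∀ n : ℤ, fourierCoeff (f : Torus → F) n = 0) : f = 0 := by
  have : SecondCountableTopology F := UniformSpace.secondCountable_of_separable F
  rw [Lp.eq_zero_iff_ae_eq_zero]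
  refine ae_eq_zero_of_forall_inner (𝕜 := ℂ) fun y => ?_
  have hm : MemLp (fun t => inner ℂ y (f t)) 2 (haarAddCircle : Measure Torus) :=
    (Lp.memLp f).const_inner y
  set g : LTwo ℂ := hm.toLp (fun t => inner ℂ y (f t)) with hg
  have hgf : g =ᵐ[haarAddCircle] fun t => inner ℂ y (f t) := hm.coeFn_toLp
  have h1 : ∀ n : ℤ, fourierCoeff (g : Torus → ℂ) n = 0 := by
    intro n
    have h3 := inner_monomial_left n y f
    rw [hf n, inner_zero_right, L2.inner_def] at h3
    rw [fourierCoeff_congr_ae hgf, ← h3]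
    refine integral_congr_ae ?_
    filter_upwards [coeFn_monomial n y] with t h1
    rw [h1, inner_smul_left, fourier_neg, smul_eq_mul]
  have h2 : g = 0 := by
    refine (LinearIsometryEquiv.map_eq_zero_iff (fourierBasis (T := 2 * Real.pi)).repr).mp ?_
    refine lp.ext (funext fun n => ?_)
    rw [fourierBasis_repr, h1 n]
    rfl
  have h3 := (Lp.eq_zero_iff_ae_eq_zero).mp h2
  exact hgf.symm.trans h3

theorem continuous_fourierCoeff [CompleteSpace F] (n : ℤ) :
    Continuous fun f : LTwo F => fourierCoeff (f : Torus → F) n := by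
  have h : (fun f : LTwo F => fourierCoeff (f : Torus → F) n)
      = ContinuousLinearMap.adjoint (monomialIsometry (F := F) n).toContinuousLinearMap := by
    ext f
    refine ext_inner_left ℂ fun y => ?_
    rw [ContinuousLinearMap.adjoint_inner_right, ← inner_monomial_left]
    rfl
  rw [h]
  exact ContinuousLinearMap.continuous _

theorem fourierCoeff_sub_Lp (f g : LTwo F) (n : ℤ) :
    fourierCoeff ((f - g : LTwo F) : Torus → F) n
      = fourierCoeff (f : Torus → F) n - fourierCoeff (g : Torus → F) n := by
  have hi : ∀ h : LTwo F, Integrable (fun t => fourier (-n) t • h t)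
      (haarAddCircle : Measure Torus) := fun h =>
    ((Lp.memLp h).integrable (by norm_num)).fourier_smul _
  unfold fourierCoeff
  rw [← integral_sub (hi f) (hi g)]
  refine integral_congr_ae ?_
  filter_upwards [Lp.coeFn_sub f g] with t ht
  rw [ht, Pi.sub_apply, smul_sub]

theorem ext_fourierCoeff [CompleteSpace F] [TopologicalSpace.SeparableSpace F] {f g : LTwo F}
    (h : ∀ n : ℤ, fourierCoeff (f : Torus → F) n = fourierCoeff (g : Torus → F) n) : f = g := by
  rw [← sub_eq_zero]
  refine eq_zero_of_fourierCoeff_eq_zero _ fun n => ?_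
  rw [fourierCoeff_sub_Lp, h, sub_self]

theorem isClosed_hardy [CompleteSpace F] : IsClosed (hardy F : Set (LTwo F)) := by
  have : (hardy F : Set (LTwo F))
      = ⋂ n : ℤ, ⋂ _ : n < 0, {f : LTwo F | fourierCoeff (f : Torus → F) n = 0} := by
    ext f
    simp only [Set.mem_iInter]
    rfl
  rw [this]
  exact isClosed_iInter fun n => isClosed_iInter fun _ =>
    isClosed_eq (continuous_fourierCoeff n) continuous_const

theorem monomial_mem_hardy [CompleteSpace F] {n : ℤ} (hn : 0 ≤ n) (y : F) :
    monomial n y ∈ hardy F := by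
  intro m hm
  rw [fourierCoeff_monomial, if_neg (by omega)]

theorem fourierMul_mem_hardy {n : ℤ} (hn : 0 ≤ n) {f : LTwo F} (hf : f ∈ hardy F) :
    fourierMul n f ∈ hardy F := by
  intro m hm
  rw [fourierCoeff_fourierMul]
  exact hf _ (by omega)

/-- A function all of whose translates `e^{int} f` lie in `H²` vanishes. -/
theorem eq_zero_of_forall_fourierMul_mem_hardy [CompleteSpace F]
    [TopologicalSpace.SeparableSpace F] (f : LTwo F) (hf : ∀ n : ℤ, fourierMul n f ∈ hardy F) :
    f = 0 := by
  refine eq_zero_of_fourierCoeff_eq_zero f fun n => ?_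
  have := hf (-n - 1) (-1) (by norm_num)
  rw [fourierCoeff_fourierMul] at this
  convert this using 2
  ring

/-- The functions `e^{int} y`, `n ≥ 0`, span a dense subspace of `H²(F)`. -/
theorem hardy_le_of_monomial_mem [CompleteSpace F] [TopologicalSpace.SeparableSpace F]
    (S : Submodule ℂ (LTwo F)) (hS : IsClosed (S : Set (LTwo F)))
    (h : ∀ n : ℤ, 0 ≤ n → ∀ y : F, monomial n y ∈ S) : hardy F ≤ S := by
  intro f hf
  have hc : IsClosed ((S ⊓ hardy F : Submodule ℂ (LTwo F)) : Set (LTwo F)) :=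
    hS.inter isClosed_hardy
  have : CompleteSpace (S ⊓ hardy F : Submodule ℂ (LTwo F)) := hc.completeSpace_coe
  obtain ⟨g, hg, p, hp, rfl⟩ := (S ⊓ hardy F).exists_add_mem_mem_orthogonal f
  have hpH : p ∈ hardy F := by
    have := sub_mem hf hg.2
    rwa [add_sub_cancel_left] at this
  -- Negative coefficients of p vanish because p ∈ H²; the others vanish because p is orthogonal to
  -- the monomials.
  have hp0 : p = 0 := by
    refine eq_zero_of_fourierCoeff_eq_zero p fun n => ?_
    rcases lt_or_ge n 0 with hn | hn
    · exact hpH n hn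
    · refine ext_inner_left ℂ fun y => ?_
      rw [← inner_monomial_left, inner_zero_right]
      exact hp _ ⟨h n hn y, monomial_mem_hardy hn y⟩
  rw [hp0, add_zero]
  exact hg.1

end Monomials

/-! ### The Poisson kernel and radial limits at Lebesgue points. -/

section Poisson

open AddCircle

/-- The Poisson kernel `(1 - r²) / |1 - r e^{ix}|²`. -/
noncomputable def poissonK (r : ℝ) (x : Torus) : ℝ :=
  (1 - r ^ 2) / ‖1 - (r : ℂ) * (toCircle x : ℂ)‖ ^ 2

theorem norm_mul_toCircle {r : ℝ} (hr : 0 ≤ r) (x : Torus) :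
    ‖(r : ℂ) * (toCircle x : ℂ)‖ = r := by
  rw [norm_mul, Circle.norm_coe, mul_one, Complex.norm_real, Real.norm_of_nonneg hr]

theorem fourier_natCast_eq (n : ℕ) (x : Torus) : fourier (n : ℤ) x = (toCircle x : ℂ) ^ n := by
  rw [fourier_apply, natCast_zsmul, toCircle_nsmul, Circle.coe_pow]

theorem one_sub_mul_toCircle_ne_zero {r : ℝ} (hr : 0 ≤ r) (hr1 : r < 1) (x : Torus) :
    1 - (r : ℂ) * (toCircle x : ℂ) ≠ 0 := by
  intro h
  have h1 := norm_mul_toCircle hr x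
  rw [← sub_eq_zero.mp h, norm_one] at h1
  exact hr1.ne h1.symm

/-- The terms n ≥ 0 and n < 0 are geometric series in w = r e^{ix} and in its conjugate. -/
theorem hasSum_poissonK {r : ℝ} (hr : 0 ≤ r) (hr1 : r < 1) (x : Torus) :
    HasSum (fun n : ℤ => (r : ℂ) ^ n.natAbs * fourier n x) (poissonK r x : ℂ) := by
  set w : ℂ := (r : ℂ) * (toCircle x : ℂ) with hw
  have hwn : ‖w‖ = r := norm_mul_toCircle hr x
  have h1 : HasSum (fun n : ℕ => w ^ n) (1 - w)⁻¹ :=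
    hasSum_geometric_of_norm_lt_one (by rwa [hwn])
  have h2 : HasSum (fun n : ℕ => (starRingEnd ℂ w) ^ n) (1 - starRingEnd ℂ w)⁻¹ :=
    hasSum_geometric_of_norm_lt_one (by rwa [RCLike.norm_conj, hwn])
  have h3 := h2.mul_left (starRingEnd ℂ w)
  have hne : 1 - w ≠ 0 := one_sub_mul_toCircle_ne_zero hr hr1 x
  have hne' : 1 - starRingEnd ℂ w ≠ 0 := by
    intro h
    apply hne
    have := congrArg (starRingEnd ℂ) h
    simpa using this
  have h4 : (poissonK r x : ℂ) = (1 - w)⁻¹ + starRingEnd ℂ w * (1 - starRingEnd ℂ w)⁻¹ := by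
    have e1 : ((‖1 - w‖ : ℂ)) ^ 2 = (1 - w) * (1 - starRingEnd ℂ w) := by
      rw [← Complex.mul_conj', map_sub, map_one]
    have e2 : (r : ℂ) ^ 2 = w * starRingEnd ℂ w := by
      rw [Complex.mul_conj', hwn]
    unfold poissonK
    push_cast
    rw [← hw, e1, e2]
    field_simp
    ring
  rw [h4]
  refine HasSum.of_nat_of_neg_add_one ?_ ?_
  · convert h1 using 2 with n
    rw [Int.natAbs_natCast, fourier_natCast_eq, hw, mul_pow]
  · refine h3.congr_fun fun n => ?_
    have e : (-((n : ℤ) + 1)).natAbs = n + 1 := by omega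
    have e' : (n : ℤ) + 1 = ((n + 1 : ℕ) : ℤ) := by push_cast; rfl
    rw [e, fourier_neg, e', fourier_natCast_eq, ← pow_succ', hw, map_mul, mul_pow,
      Complex.conj_ofReal, map_pow]

theorem poissonK_nonneg {r : ℝ} (hr : 0 ≤ r) (hr1 : r < 1) (x : Torus) : 0 ≤ poissonK r x :=
  div_nonneg (by nlinarith) (sq_nonneg _)

theorem continuous_poissonK {r : ℝ} (hr : 0 ≤ r) (hr1 : r < 1) : Continuous (poissonK r) := by
  unfold poissonK
  refine continuous_const.div ?_ fun x => ?_
  · exact (continuous_const.sub (continuous_const.mul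
      (continuous_subtype_val.comp continuous_toCircle))).norm.pow 2
  · exact pow_ne_zero 2 (norm_ne_zero_iff.mpr (one_sub_mul_toCircle_ne_zero hr hr1 x))

/-- |1 - r e^{iθ}|² = (1 - r)² + 2r(1 - cos θ), where 2r ≥ 1 and 1 - cos θ ≥ 2θ²/π² ≥ θ²/5 for |θ| ≤
π. With 1 - r² ≤ 2(1 - r) this gives the constant 10 = 2 · 5. -/
theorem poissonK_le {r : ℝ} (hr : 1 / 2 ≤ r) (hr1 : r < 1) (x : Torus) :
    poissonK r x ≤ 10 * (1 - r) / ((1 - r) ^ 2 + ‖x‖ ^ 2) := by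
  obtain ⟨θ, rfl⟩ := QuotientAddGroup.mk_surjective x
  have hx : ∃ θ' : ℝ, (θ' : Torus) = (θ : Torus) ∧ |θ'| ≤ Real.pi := by
    refine ⟨toIocMod Real.two_pi_pos (-Real.pi) θ, ?_, ?_⟩
    · rw [toIocMod, AddCircle.coe_sub, sub_eq_self, AddCircle.coe_eq_zero_iff]
      exact ⟨_, rfl⟩
    · have := toIocMod_mem_Ioc Real.two_pi_pos (-Real.pi) θ
      rw [abs_le]
      constructor <;> linarith [this.1, this.2]
  obtain ⟨θ', h1, h2⟩ := hx
  change poissonK r (θ : Torus) ≤ 10 * (1 - r) / ((1 - r) ^ 2 + ‖(θ : Torus)‖ ^ 2)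
  rw [← h1]
  have hn : ‖(θ' : Torus)‖ = |θ'| := by
    rw [AddCircle.norm_coe_eq_abs_iff _ Real.two_pi_pos.ne']
    rw [abs_of_pos Real.two_pi_pos]
    linarith
  have hsq : ‖1 - (r : ℂ) * (toCircle (θ' : Torus) : ℂ)‖ ^ 2
      = (1 - r) ^ 2 + 2 * r * (1 - Real.cos θ') := by
    rw [toCircle_apply_mk, div_self Real.two_pi_pos.ne', one_mul, Circle.coe_exp,
      Complex.sq_norm, Complex.normSq_apply]
    simp only [Complex.sub_re, Complex.one_re, Complex.re_ofReal_mul, Complex.exp_ofReal_mul_I_re,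
      Complex.sub_im, Complex.one_im, Complex.im_ofReal_mul, Complex.exp_ofReal_mul_I_im]
    nlinarith [Real.sin_sq_add_cos_sq θ']
  have hcos := Real.cos_le_one_sub_mul_cos_sq h2
  have hpi : Real.pi ^ 2 ≤ 10 := by nlinarith [Real.pi_lt_d2, Real.pi_pos]
  have hcos2 : θ' ^ 2 / 5 ≤ 1 - Real.cos θ' := by
    have : 1 / 5 ≤ 2 / Real.pi ^ 2 := by
      rw [div_le_div_iff₀ (by norm_num) (by positivity)]
      linarith
    nlinarith [sq_nonneg θ']
  have hlow : ((1 - r) ^ 2 + θ' ^ 2) / 5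
      ≤ ‖1 - (r : ℂ) * (toCircle (θ' : Torus) : ℂ)‖ ^ 2 := by
    rw [hsq]
    nlinarith [sq_nonneg θ', sq_nonneg (1 - r)]
  have hpos : 0 < (1 - r) ^ 2 + θ' ^ 2 := by
    have : 0 < 1 - r := by linarith
    positivity
  unfold poissonK
  rw [hn, sq_abs]
  calc (1 - r ^ 2) / ‖1 - (r : ℂ) * (toCircle (θ' : Torus) : ℂ)‖ ^ 2
      ≤ (2 * (1 - r)) / (((1 - r) ^ 2 + θ' ^ 2) / 5) := by
        gcongr
        nlinarith
    _ = 10 * (1 - r) / ((1 - r) ^ 2 + θ' ^ 2) := by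
        field_simp
        ring

/-- Dyadic domination of the Poisson kernel by multiples of indicators of balls. -/
theorem exists_poissonK_le {r : ℝ} (hr : 1 / 2 ≤ r) (hr1 : r < 1) (x : Torus) :
    ∃ n : ℕ, ‖x‖ ≤ 2 ^ n * (1 - r) ∧ poissonK r x ≤ 40 / (4 ^ n * (1 - r)) := by
  have hh : 0 < 1 - r := by linarith
  have hex : ∃ n : ℕ, ‖x‖ ≤ 2 ^ n * (1 - r) := by
    obtain ⟨n, hn⟩ := pow_unbounded_of_one_lt (‖x‖ / (1 - r)) (one_lt_two (α := ℝ))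
    exact ⟨n, ((div_lt_iff₀ hh).mp hn).le⟩
  classical
  -- With n minimal, either n = 0 or ‖x‖ > 2^(n-1) (1 - r). In the second case ‖x‖² ≥ 4^n (1 - r)² /
  -- 4, whence 40 = 10 · 4.
  refine ⟨Nat.find hex, Nat.find_spec hex, (poissonK_le hr hr1 x).trans ?_⟩
  rw [div_le_div_iff₀ (by positivity) (by positivity)]
  rcases Nat.eq_zero_or_pos (Nat.find hex) with h0 | h0
  · rw [h0]
    nlinarith [sq_nonneg ‖x‖]
  · obtain ⟨m, hm⟩ := Nat.exists_eq_succ_of_ne_zero h0.ne'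
    have h1 : 2 ^ m * (1 - r) < ‖x‖ := not_le.mp (Nat.find_min hex (m := m) (by omega))
    have h2 : (2 ^ m * (1 - r)) ^ 2 ≤ ‖x‖ ^ 2 := by gcongr
    rw [hm]
    have h3 : (4 : ℝ) ^ (m + 1) = 4 * (2 ^ m) ^ 2 := by
      rw [pow_succ, ← pow_mul, mul_comm m 2, pow_mul]
      norm_num
      ring
    rw [Nat.succ_eq_add_one, h3]
    nlinarith [sq_nonneg (1 - r)]

/-- Put h = 1 - r. The dyadic bound gives ∫ P G ≤ Σ 40/(4^n h) ∫_{B(t, 2^n h)} G = Σ 40 · 2^{-n}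
φ(2^n h), where φ is bounded and tends to 0 at 0. Dominated convergence for series applies. -/
theorem tendsto_integral_poissonK_mul {G : Torus → ℝ} (hG : Integrable G) (hG0 : ∀ s, 0 ≤ G s)
    (t : Torus)
    (h : Tendsto (fun ρ : ℝ => ρ⁻¹ * ∫ s in Metric.closedBall t ρ, G s) (𝓝[>] 0) (𝓝 0)) :
    Tendsto (fun r : ℝ => ∫ s, poissonK r (t - s) * G s) (𝓝[<] 1) (𝓝 0) := by
  set φ : ℝ → ℝ := fun ρ => ρ⁻¹ * ∫ s in Metric.closedBall t ρ, G s with hφ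
  have hφ0 : ∀ ρ, 0 < ρ → 0 ≤ φ ρ := fun ρ hρ =>
    mul_nonneg (inv_nonneg.mpr hρ.le) (integral_nonneg fun s => hG0 s)
  -- Near 0 the limit bounds φ; away from 0 the total integral of G does.
  have hbdd : ∃ M, ∀ ρ, 0 < ρ → φ ρ ≤ M := by
    have h1 := h.eventually (gt_mem_nhds (zero_lt_one (α := ℝ)))
    obtain ⟨δ, hδ, h2⟩ := mem_nhdsGT_iff_exists_Ioo_subset.mp h1
    refine ⟨max 1 (δ⁻¹ * ∫ s, G s), fun ρ hρ => ?_⟩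
    rcases lt_or_ge ρ δ with h3 | h3
    · exact (h2 ⟨hρ, h3⟩ : φ ρ < 1).le.trans (le_max_left _ _)
    · refine le_trans ?_ (le_max_right _ _)
      have hδ' : 0 < δ := hδ
      exact mul_le_mul (inv_anti₀ hδ' h3)
        (setIntegral_le_integral hG (Eventually.of_forall hG0))
        (integral_nonneg fun s => hG0 s) (inv_nonneg.mpr hδ'.le)
  obtain ⟨M, hM⟩ := hbdd
  have hgeo : Summable fun n : ℕ => 40 * (1 / 2 : ℝ) ^ n * M :=
    ((summable_geometric_two).mul_left 40).mul_right M
  have hh : Tendsto (fun r : ℝ => 1 - r) (𝓝[<] 1) (𝓝[>] 0) := by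
    refine tendsto_nhdsWithin_iff.mpr ⟨?_, ?_⟩
    · have : Tendsto (fun r : ℝ => 1 - r) (𝓝 1) (𝓝 (1 - 1)) :=
        (continuous_const.sub continuous_id).tendsto 1
      rw [sub_self] at this
      exact this.mono_left nhdsWithin_le_nhds
    · filter_upwards [self_mem_nhdsWithin] with r hr
      exact sub_pos.mpr (Set.mem_Iio.mp hr)
  have hscale : ∀ n : ℕ, Tendsto (fun r : ℝ => 2 ^ n * (1 - r)) (𝓝[<] 1) (𝓝[>] 0) := by
    intro n
    refine tendsto_nhdsWithin_iff.mpr ⟨?_, ?_⟩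
    · have := (tendsto_nhds_of_tendsto_nhdsWithin hh).const_mul ((2 : ℝ) ^ n)
      rwa [mul_zero] at this
    · filter_upwards [self_mem_nhdsWithin] with r hr
      have : 0 < 1 - r := sub_pos.mpr (Set.mem_Iio.mp hr)
      exact mul_pos (by positivity) this
  have hsum : Tendsto (fun r : ℝ => ∑' n : ℕ, 40 * (1 / 2 : ℝ) ^ n * φ (2 ^ n * (1 - r)))
      (𝓝[<] 1) (𝓝 0) := by
    have := tendsto_tsum_of_dominated_convergence (𝓕 := 𝓝[<] (1 : ℝ))
      (f := fun (r : ℝ) (n : ℕ) => 40 * (1 / 2 : ℝ) ^ n * φ (2 ^ n * (1 - r)))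
      (g := fun _ => 0) hgeo
      (fun n => by simpa using (h.comp (hscale n)).const_mul (40 * (1 / 2 : ℝ) ^ n)) ?_
    · simpa using this
    · filter_upwards [self_mem_nhdsWithin] with r hr n
      have hr0 : 0 < 1 - r := sub_pos.mpr (Set.mem_Iio.mp hr)
      have h0 : 0 < 2 ^ n * (1 - r) := mul_pos (by positivity) hr0
      rw [Real.norm_of_nonneg (mul_nonneg (by positivity) (hφ0 _ h0))]
      exact mul_le_mul_of_nonneg_left (hM _ h0) (by positivity)
  refine squeeze_zero' ?_ ?_ hsum
  · filter_upwards [Ioo_mem_nhdsLT (show (1 / 2 : ℝ) < 1 by norm_num)] with r hr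
    exact integral_nonneg fun s =>
      mul_nonneg (poissonK_nonneg (by linarith [hr.1]) hr.2 _) (hG0 s)
  · filter_upwards [Ioo_mem_nhdsLT (show (1 / 2 : ℝ) < 1 by norm_num)] with r hr
    have hr0 : 0 < 1 - r := sub_pos.mpr hr.2
    have hnn : ∀ n : ℕ, 0 ≤ 40 * (1 / 2 : ℝ) ^ n * φ (2 ^ n * (1 - r)) := fun n =>
      mul_nonneg (by positivity) (hφ0 _ (mul_pos (by positivity) hr0))
    have hsm : Summable fun n : ℕ => 40 * (1 / 2 : ℝ) ^ n * φ (2 ^ n * (1 - r)) :=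
      hgeo.of_nonneg_of_le hnn fun n =>
        mul_le_mul_of_nonneg_left (hM _ (mul_pos (by positivity) hr0)) (by positivity)
    -- In extended nonnegative integrals, sum and integral may be exchanged freely; at each s a
    -- single term of the series already dominates P G.
    rw [← ENNReal.ofReal_le_ofReal_iff (tsum_nonneg hnn), ENNReal.ofReal_tsum_of_nonneg hnn hsm]
    have hterm : ∀ n : ℕ, ENNReal.ofReal (40 * (1 / 2 : ℝ) ^ n * φ (2 ^ n * (1 - r)))
        = ∫⁻ s, ENNReal.ofReal ((40 / (4 ^ n * (1 - r))) *
            (Metric.closedBall t (2 ^ n * (1 - r))).indicator G s) := by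
      intro n
      have hi : Integrable ((Metric.closedBall t (2 ^ n * (1 - r))).indicator G) :=
        hG.indicator Metric.isClosed_closedBall.measurableSet
      rw [← ofReal_integral_eq_lintegral_ofReal (hi.const_mul _)
        (Eventually.of_forall fun s => mul_nonneg (by positivity)
          (Set.indicator_nonneg (fun s _ => hG0 s) s)),
        integral_const_mul, integral_indicator Metric.isClosed_closedBall.measurableSet]
      congr 1
      simp only [hφ]
      rw [← mul_assoc]
      congr 1
      have h4 : (4 : ℝ) ^ n = 2 ^ n * 2 ^ n := by rw [← mul_pow]; norm_num
      rw [h4, one_div, inv_pow]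
      field_simp
    have hPG : Integrable fun s => poissonK r (t - s) * G s := by
      have hc : Continuous fun s => poissonK r (t - s) :=
        (continuous_poissonK (by linarith [hr.1]) hr.2).comp (continuous_const.sub continuous_id)
      obtain ⟨C, hC⟩ := isCompact_univ.exists_bound_of_continuousOn hc.continuousOn
      exact hG.bdd_mul (c := C) hc.aestronglyMeasurable (Eventually.of_forall fun s => hC s trivial)
    rw [ofReal_integral_eq_lintegral_ofReal hPG (Eventually.of_forall fun s =>
      mul_nonneg (poissonK_nonneg (by linarith [hr.1]) hr.2 _) (hG0 s))]
    simp_rw [hterm]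
    rw [← lintegral_tsum fun n => ((hG.indicator
      Metric.isClosed_closedBall.measurableSet).const_mul _).aestronglyMeasurable.aemeasurable.ennreal_ofReal]
    refine lintegral_mono fun s => ?_
    obtain ⟨n, hn1, hn2⟩ := exists_poissonK_le hr.1.le hr.2 (t - s)
    refine le_trans ?_ (ENNReal.le_tsum n)
    refine ENNReal.ofReal_le_ofReal ?_
    have hs : s ∈ Metric.closedBall t (2 ^ n * (1 - r)) := by
      rw [Metric.mem_closedBall', dist_eq_norm]
      exact hn1
    rw [Set.indicator_of_mem hs]
    exact mul_le_mul_of_nonneg_right hn2 (hG0 s)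

variable {F : Type*} [NormedAddCommGroup F]

/-- Almost every t is a Lebesgue point of g, so the preceding lemma applies to G = ‖g - g(t)‖. -/
theorem ae_tendsto_integral_poissonK_mul_norm_sub {g : Torus → F} (hg : Integrable g) :
    ∀ᵐ t, Tendsto (fun r : ℝ => ∫ s, poissonK r (t - s) * ‖g s - g t‖) (𝓝[<] 1) (𝓝 0) := by
  filter_upwards [IsUnifLocDoublingMeasure.ae_tendsto_average_norm_sub
    (μ := (volume : Measure Torus)) hg.locallyIntegrable 1] with t ht
  refine tendsto_integral_poissonK_mul (hg.sub (integrable_const _)).norm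
    (fun s => norm_nonneg _) t ?_
  have h1 := ht (l := 𝓝[>] (0 : ℝ)) (fun _ => t) (fun ρ => ρ) tendsto_id (by
    filter_upwards [self_mem_nhdsWithin] with ρ hρ
    exact Metric.mem_closedBall_self (by simpa using (le_of_lt hρ)))
  -- The average is over a ball of measure 2ρ, whereas the required quantity divides by ρ.
  have h2 := h1.const_mul 2
  rw [mul_zero] at h2
  refine h2.congr' ?_
  filter_upwards [Ioo_mem_nhdsGT Real.pi_pos] with ρ hρ
  have hv : (volume : Measure Torus).real (Metric.closedBall t ρ) = 2 * ρ := by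
    rw [Measure.real, volume_closedBall, min_eq_right (by linarith [hρ.2]),
      ENNReal.toReal_ofReal (by linarith [hρ.1])]
  rw [setAverage_eq, hv, smul_eq_mul, mul_inv]
  have : ρ ≠ 0 := hρ.1.ne'
  field_simp
  rfl

theorem integrable_haarAddCircle_iff {g : Torus → F} :
    Integrable g (haarAddCircle : Measure Torus) ↔ Integrable g := by
  rw [volume_eq_smul_haarAddCircle, integrable_smul_measure]
  · simp [Real.pi_pos]
  · exact ENNReal.ofReal_ne_top

variable [InnerProductSpace ℂ F]

theorem integrable_poissonK_smul {r : ℝ} (hr : 0 ≤ r) (hr1 : r < 1) (t : Torus) {g : Torus → F}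
    (hg : Integrable g (haarAddCircle : Measure Torus)) :
    Integrable (fun s => (poissonK r (t - s) : ℂ) • g s) (haarAddCircle : Measure Torus) := by
  have hc : Continuous fun s => (poissonK r (t - s) : ℂ) :=
    Complex.continuous_ofReal.comp
      ((continuous_poissonK hr hr1).comp (continuous_const.sub continuous_id))
  obtain ⟨C, hC⟩ := isCompact_univ.exists_bound_of_continuousOn hc.continuousOn
  exact hg.bdd_smul C hc.aestronglyMeasurable (Eventually.of_forall fun s => hC s trivial)

/-- The Poisson integral of `g` is the Abel mean of its Fourier series. -/
theorem hasSum_integral_poissonK_smul {r : ℝ} (hr : 0 ≤ r) (hr1 : r < 1) (t : Torus)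
    {g : Torus → F} (hg : Integrable g (haarAddCircle : Measure Torus)) :
    HasSum (fun n : ℤ => ((r : ℂ) ^ n.natAbs * fourier n t) • fourierCoeff g n)
      (∫ s, (poissonK r (t - s) : ℂ) • g s ∂haarAddCircle) := by
  have hexp : ∀ (n : ℤ) (s : Torus), fourier n (t - s) = fourier n t * fourier (-n) s := by
    intro n s
    rw [fourier_apply, fourier_apply, fourier_apply, ← Circle.coe_mul, ← toCircle_add]
    congr 2
    rw [smul_sub, neg_smul, sub_eq_add_neg]
  have hcoef : ∀ n : ℤ, ((r : ℂ) ^ n.natAbs * fourier n t) • fourierCoeff g n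
      = ∫ s, ((r : ℂ) ^ n.natAbs * fourier n (t - s)) • g s ∂haarAddCircle := by
    intro n
    rw [fourierCoeff, ← integral_smul]
    congr 1
    ext s
    rw [hexp, smul_smul, mul_assoc]
  have hi : ∀ n : ℤ, Integrable (fun s => ((r : ℂ) ^ n.natAbs * fourier n (t - s)) • g s)
      (haarAddCircle : Measure Torus) := by
    intro n
    have := (hg.fourier_smul (-n)).smul ((r : ℂ) ^ n.natAbs * fourier n t)
    refine this.congr (Eventually.of_forall fun s => ?_)
    simp only [Pi.smul_apply]
    rw [hexp, smul_smul, mul_assoc]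
  have hnorm : ∀ n : ℤ, ∫ s, ‖((r : ℂ) ^ n.natAbs * fourier n (t - s)) • g s‖ ∂haarAddCircle
      = r ^ n.natAbs * ∫ s, ‖g s‖ ∂haarAddCircle := by
    intro n
    rw [← integral_const_mul]
    congr 1
    ext s
    rw [norm_smul, norm_mul, norm_fourier_apply, mul_one, norm_pow, Complex.norm_real,
      Real.norm_of_nonneg hr]
  have hgeo : Summable fun n : ℤ => r ^ n.natAbs := by
    refine Summable.of_nat_of_neg_add_one ?_ ?_
    · simpa using summable_geometric_of_lt_one hr hr1
    · have : ∀ n : ℕ, (-((n : ℤ) + 1)).natAbs = n + 1 := fun n => by omega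
      simp_rw [this, pow_succ]
      exact (summable_geometric_of_lt_one hr hr1).mul_right r
  have hsum : Summable fun n : ℤ =>
      ∫ s, ‖((r : ℂ) ^ n.natAbs * fourier n (t - s)) • g s‖ ∂haarAddCircle := by
    simp_rw [hnorm]
    exact hgeo.mul_right _
  have key := hasSum_integral_of_summable_integral_norm hi hsum
  simp_rw [← hcoef] at key
  convert key using 1
  congr 1
  ext s
  exact ((hasSum_poissonK hr hr1 (t - s)).smul_const (g s)).tsum_eq.symm

/-- In the Abel series of the constant function 1, only the term n = 0 survives. -/
theorem integral_poissonK {r : ℝ} (hr : 0 ≤ r) (hr1 : r < 1) (t : Torus) :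
    ∫ s, (poissonK r (t - s) : ℂ) ∂haarAddCircle = 1 := by
  have h := hasSum_integral_poissonK_smul hr hr1 t (g := (fourier 0 : Torus → ℂ))
    ((fourier 0).continuous.integrable_of_hasCompactSupport
      (HasCompactSupport.of_compactSpace _))
  have h2 := hasSum_single (f := fun n : ℤ => ((r : ℂ) ^ n.natAbs * fourier n t) •
    fourierCoeff (fourier 0 : Torus → ℂ) n) 0 (fun n hn => by
      rw [fourierCoeff_fourier, Pi.single_eq_of_ne hn, smul_zero])
  have h3 := h.unique h2
  rw [fourierCoeff_fourier] at h3
  simpa using h3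

/-- Fatou's theorem: the Poisson integrals converge radially almost everywhere. -/
theorem ae_tendsto_integral_poissonK_smul [CompleteSpace F] {g : Torus → F}
    (hg : Integrable g (haarAddCircle : Measure Torus)) :
    ∀ᵐ t ∂(haarAddCircle : Measure Torus),
      Tendsto (fun r : ℝ => ∫ s, (poissonK r (t - s) : ℂ) • g s ∂haarAddCircle) (𝓝[<] 1)
        (𝓝 (g t)) := by
  have h := ae_tendsto_integral_poissonK_mul_norm_sub (integrable_haarAddCircle_iff.mp hg)
  have hac : (haarAddCircle : Measure Torus) ≪ volume := by
    rw [volume_eq_smul_haarAddCircle]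
    exact Measure.absolutelyContinuous_smul (by simp [Real.pi_pos])
  filter_upwards [hac.ae_le h] with t ht
  rw [tendsto_iff_norm_sub_tendsto_zero]
  have ht' := ht.const_mul (2 * Real.pi)⁻¹
  rw [mul_zero] at ht'
  refine squeeze_zero' (Eventually.of_forall fun r => norm_nonneg _) ?_ ht'
  filter_upwards [Ioo_mem_nhdsLT (zero_lt_one (α := ℝ))] with r hr
  -- Since the kernel has mean 1, g(t) is the Poisson integral of a constant, and the difference is
  -- controlled by ‖g(s) - g(t)‖.
  have e1 : g t = ∫ s, (poissonK r (t - s) : ℂ) • g t ∂haarAddCircle := by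
    rw [integral_smul_const, integral_poissonK hr.1.le hr.2, one_smul]
  conv_lhs => rw [e1]
  rw [← integral_sub (integrable_poissonK_smul hr.1.le hr.2 t hg)
    (integrable_poissonK_smul hr.1.le hr.2 t (integrable_const _))]
  refine (norm_integral_le_integral_norm _).trans_eq ?_
  rw [integral_haarAddCircle, smul_eq_mul]
  congr 2
  ext s
  rw [← smul_sub, norm_smul, Complex.norm_real,
    Real.norm_of_nonneg (poissonK_nonneg hr.1.le hr.2 _)]

end Poisson

/-! ### Bounded vector-valued power series as Poisson integrals of H² functions. -/

section PowerSeries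

open AddCircle

variable {F : Type*} [NormedAddCommGroup F] [InnerProductSpace ℂ F]

theorem summable_pow_mul_norm_of_summable {c : ℕ → F} {r R : ℝ} (hr : 0 ≤ r) (hrR : r < R)
    (h : Summable fun n => ((R : ℂ) ^ n) • c n) : Summable fun n => r ^ n * ‖c n‖ := by
  have hR : 0 < R := hr.trans_lt hrR
  obtain ⟨C, hC⟩ := h.tendsto_atTop_zero.norm.bddAbove_range
  have hgeo : Summable fun n : ℕ => (r / R) ^ n * C :=
    (summable_geometric_of_lt_one (div_nonneg hr hR.le) ((div_lt_one hR).mpr hrR)).mul_right C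
  refine hgeo.of_nonneg_of_le (fun n => by positivity) fun n => ?_
  have h1 : ‖((R : ℂ) ^ n) • c n‖ ≤ C := hC ⟨n, rfl⟩
  rw [norm_smul, norm_pow, Complex.norm_real, Real.norm_of_nonneg hR.le] at h1
  calc r ^ n * ‖c n‖ = (r / R) ^ n * (R ^ n * ‖c n‖) := by
        rw [div_pow]
        field_simp
    _ ≤ (r / R) ^ n * C := by gcongr

/-- The continuous function `t ↦ e^{int} y`. -/
noncomputable def monomialC (n : ℤ) (y : F) : C(Torus, F) :=
  ⟨fun t => fourier n t • y, (fourier n).continuous.smul continuous_const⟩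

theorem norm_monomialC_le (n : ℤ) (y : F) : ‖monomialC n y‖ ≤ ‖y‖ := by
  rw [ContinuousMap.norm_le _ (norm_nonneg _)]
  intro t
  change ‖fourier n t • y‖ ≤ _
  rw [norm_smul, norm_fourier_apply, one_mul]

theorem toLp_monomialC (n : ℤ) (y : F) :
    ContinuousMap.toLp (E := F) 2 haarAddCircle ℂ (monomialC n y) = monomialIsometry n y := by
  refine Lp.ext ?_
  filter_upwards [ContinuousMap.coeFn_toLp (𝕜 := ℂ) (p := 2)
    (haarAddCircle : Measure Torus) (monomialC n y), coeFn_monomial n y] with t h1 h2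
  rw [h1, monomialIsometry_apply, h2]
  rfl

theorem norm_mul_toCircle_lt_one {r : ℝ} (hr : 0 ≤ r) (hr1 : r < 1) (t : Torus) :
    (r : ℂ) * (toCircle t : ℂ) ∈ Metric.ball (0 : ℂ) 1 := by
  rw [mem_ball_zero_iff, norm_mul_toCircle hr]
  exact hr1

variable [CompleteSpace F] {c : ℕ → F} {f : ℂ → F}

/-- The dilations `f (r e^{it})` of a power series, as sums in `C(Torus, F)`. -/
theorem hasSum_monomialC (hf : ∀ z ∈ Metric.ball (0 : ℂ) 1, HasSum (fun n => z ^ n • c n) (f z))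
    {r : ℝ} (hr : 0 ≤ r) (hr1 : r < 1) :
    ∃ g : C(Torus, F), (∀ t, g t = f ((r : ℂ) * (toCircle t : ℂ))) ∧
      HasSum (fun n : ℕ => monomialC n ((r : ℂ) ^ n • c n)) g := by
  obtain ⟨R, hrR, hR1⟩ := exists_between hr1
  have hR : (R : ℂ) ∈ Metric.ball (0 : ℂ) 1 := by
    rw [mem_ball_zero_iff, Complex.norm_real, Real.norm_of_nonneg (hr.trans hrR.le)]
    exact hR1
  have hs := summable_pow_mul_norm_of_summable hr hrR (hf _ hR).summable
  have hsum : Summable fun n : ℕ => monomialC (n : ℤ) ((r : ℂ) ^ n • c n) := by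
    refine Summable.of_norm_bounded hs fun n => (norm_monomialC_le _ _).trans_eq ?_
    rw [norm_smul, norm_pow, Complex.norm_real, Real.norm_of_nonneg hr]
  refine ⟨_, fun t => ?_, hsum.hasSum⟩
  have h1 := (ContinuousMap.evalCLM ℂ t).hasSum hsum.hasSum
  have h2 := hf _ (norm_mul_toCircle_lt_one hr hr1 t)
  refine h1.unique (h2.congr_fun fun n => ?_)
  change fourier (n : ℤ) t • ((r : ℂ) ^ n • c n) = _
  rw [fourier_natCast_eq, smul_smul, mul_pow, mul_comm]

/-- Orthogonality on the circle of radius r gives Σ r^{2n}‖c_n‖² ≤ C²; in each finite sum r may tend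
to 1. -/
theorem sum_norm_sq_le {C : ℝ}
    (hf : ∀ z ∈ Metric.ball (0 : ℂ) 1, HasSum (fun n => z ^ n • c n) (f z))
    (hC : ∀ z ∈ Metric.ball (0 : ℂ) 1, ‖f z‖ ≤ C) (N : ℕ) :
    ∑ n ∈ Finset.range N, ‖c n‖ ^ 2 ≤ C ^ 2 := by
  have hC0 : 0 ≤ C := (norm_nonneg _).trans (hC 0 (by simp))
  have hfam : OrthogonalFamily ℂ (fun _ : ℕ => F) (fun n : ℕ => monomialIsometry (F := F) n) :=
    orthogonalFamily_monomial.comp Nat.cast_injective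
  have key : ∀ r : ℝ, 0 ≤ r → r < 1 →
      ∑ n ∈ Finset.range N, (r ^ n * ‖c n‖) ^ 2 ≤ C ^ 2 := by
    intro r hr hr1
    obtain ⟨g, hg, hsum⟩ := hasSum_monomialC hf hr hr1
    have hgn : ‖ContinuousMap.toLp (E := F) 2 (haarAddCircle : Measure Torus) ℂ g‖ ≤ C := by
      refine (ContinuousLinearMap.le_opNorm _ _).trans ?_
      have h1 := ContinuousMap.toLp_norm_le (E := F) (p := 2) (𝕜 := ℂ)
        (haarAddCircle : Measure Torus)
      have h2 : ‖g‖ ≤ C := by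
        rw [ContinuousMap.norm_le _ hC0]
        intro t
        rw [hg]
        exact hC _ (norm_mul_toCircle_lt_one hr hr1 t)
      have h3 : ((measureUnivNNReal (haarAddCircle : Measure Torus) ^ (2 : ℝ≥0∞).toReal⁻¹ :
          NNReal) : ℝ) = 1 := by
        simp [measureUnivNNReal]
      have h4 : ‖(ContinuousMap.toLp 2 haarAddCircle ℂ : C(Torus, F) →L[ℂ] LTwo F)‖ ≤ 1 :=
        h1.trans_eq h3
      calc _ ≤ 1 * ‖g‖ := by gcongr
        _ ≤ C := by rwa [one_mul]
    have hL := (ContinuousMap.toLp (E := F) 2 (haarAddCircle : Measure Torus) ℂ).hasSum hsum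
    have hL2 : HasSum (fun n : ℕ => monomialIsometry (F := F) n ((r : ℂ) ^ n • c n))
        (ContinuousMap.toLp (E := F) 2 (haarAddCircle : Measure Torus) ℂ g) :=
      hL.congr_fun fun n => (toLp_monomialC _ _).symm
    have hlim := (hL2.tendsto_sum_nat.norm).pow 2
    have hterm : ∀ M : ℕ,
        ‖∑ n ∈ Finset.range M, monomialIsometry (F := F) n ((r : ℂ) ^ n • c n)‖ ^ 2
          = ∑ n ∈ Finset.range M, (r ^ n * ‖c n‖) ^ 2 := by
      intro M
      rw [hfam.norm_sum (fun n => (r : ℂ) ^ n • c n) (Finset.range M)]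
      refine Finset.sum_congr rfl fun n _ => ?_
      rw [norm_smul, norm_pow, Complex.norm_real, Real.norm_of_nonneg hr]
    simp_rw [hterm] at hlim
    have hmono : Monotone fun M : ℕ => ∑ n ∈ Finset.range M, (r ^ n * ‖c n‖) ^ 2 :=
      fun a b hab => Finset.sum_le_sum_of_subset_of_nonneg
        (Finset.range_subset_range.mpr hab) fun _ _ _ => sq_nonneg _
    exact (hmono.ge_of_tendsto hlim N).trans (pow_le_pow_left₀ (norm_nonneg _) hgn 2)
  have hcont : Tendsto (fun r : ℝ => ∑ n ∈ Finset.range N, (r ^ n * ‖c n‖) ^ 2) (𝓝[<] 1)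
      (𝓝 (∑ n ∈ Finset.range N, ((1 : ℝ) ^ n * ‖c n‖) ^ 2)) := by
    have : Continuous fun r : ℝ => ∑ n ∈ Finset.range N, (r ^ n * ‖c n‖) ^ 2 := by fun_prop
    exact (this.tendsto 1).mono_left nhdsWithin_le_nhds
  simp only [one_pow, one_mul] at hcont
  refine le_of_tendsto hcont ?_
  filter_upwards [Ioo_mem_nhdsLT (zero_lt_one (α := ℝ))] with r hr
  exact key r hr.1.le hr.2

/-- A bounded analytic function on the disc is the Poisson integral of a function in `H²`, which is
almost everywhere its radial limit. -/
theorem exists_hardy_ae_tendsto {C : ℝ}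
    (hf : ∀ z ∈ Metric.ball (0 : ℂ) 1, HasSum (fun n => z ^ n • c n) (f z))
    (hC : ∀ z ∈ Metric.ball (0 : ℂ) 1, ‖f z‖ ≤ C) :
    ∃ g ∈ hardy F, (∀ n : ℕ, fourierCoeff (g : Torus → F) n = c n) ∧
      ∀ᵐ t ∂(haarAddCircle : Measure Torus),
        Tendsto (fun r : ℝ => f ((r : ℂ) * (toCircle t : ℂ))) (𝓝[<] 1) (𝓝 (g t)) := by
  have hfam : OrthogonalFamily ℂ (fun _ : ℕ => F) (fun n : ℕ => monomialIsometry (F := F) n) :=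
    orthogonalFamily_monomial.comp Nat.cast_injective
  have hs : Summable fun n => ‖c n‖ ^ 2 :=
    summable_of_sum_range_le (fun n => sq_nonneg _) (sum_norm_sq_le hf hC)
  obtain ⟨g, hg⟩ := (hfam.summable_iff_norm_sq_summable c).mpr hs
  have hcoef : ∀ m : ℤ, HasSum (fun n : ℕ => if (n : ℤ) = m then c n else 0)
      (fourierCoeff (g : Torus → F) m) := by
    intro m
    have h1 := (ContinuousLinearMap.adjoint
      (monomialIsometry (F := F) m).toContinuousLinearMap).hasSum hg
    have h2 : ∀ f : LTwo F, ContinuousLinearMap.adjoint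
        (monomialIsometry (F := F) m).toContinuousLinearMap f
        = fourierCoeff (f : Torus → F) m := by
      intro f
      refine ext_inner_left ℂ fun y => ?_
      rw [ContinuousLinearMap.adjoint_inner_right, ← inner_monomial_left]
      rfl
    rw [h2] at h1
    refine h1.congr_fun fun n => ?_
    rw [h2, monomialIsometry_apply, fourierCoeff_monomial]
  have hneg : ∀ m : ℤ, m < 0 → fourierCoeff (g : Torus → F) m = 0 := by
    intro m hm
    refine (hcoef m).unique (hasSum_zero.congr_fun fun n => ?_)
    rw [if_neg (by omega)]
  have hpos : ∀ n : ℕ, fourierCoeff (g : Torus → F) n = c n := by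
    intro n
    refine (hcoef n).unique ((hasSum_ite_eq n (c n)).congr_fun fun m => ?_)
    by_cases h : m = n <;> simp [h]
  refine ⟨g, hneg, hpos, ?_⟩
  have hgi : Integrable g (haarAddCircle : Measure Torus) :=
    (Lp.memLp g).integrable (by norm_num)
  filter_upwards [ae_tendsto_integral_poissonK_smul hgi] with t ht
  refine ht.congr' ?_
  filter_upwards [Ioo_mem_nhdsLT (zero_lt_one (α := ℝ))] with r hr
  refine (hasSum_integral_poissonK_smul hr.1.le hr.2 t hgi).unique ?_
  have h1 := hf _ (norm_mul_toCircle_lt_one hr.1.le hr.2 t)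
  rw [← add_zero (f _)]
  refine HasSum.of_nat_of_neg_add_one (h1.congr_fun fun n => ?_) (hasSum_zero.congr_fun fun n => ?_)
  · rw [hpos, Int.natAbs_natCast, fourier_natCast_eq, mul_pow]
  · rw [hneg _ (by omega), smul_zero]

end PowerSeries

/-! ### Boundary values of operator functions and their multiplication operators. -/

section MulOp

open AddCircle

variable {E F G : Type*} [NormedAddCommGroup E] [InnerProductSpace ℂ E]
  [NormedAddCommGroup F] [InnerProductSpace ℂ F] [NormedAddCommGroup G] [InnerProductSpace ℂ G]

theorem HasBoundaryValue.unique {Θ : ContractiveAnalytic E F} {t : Torus} {A B : E →L[ℂ] F}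
    (hA : Θ.HasBoundaryValue t A) (hB : Θ.HasBoundaryValue t B) : A = B := by
  ext e
  exact tendsto_nhds_unique (hA e) (hB e)

theorem ContractiveAnalytic.norm_apply_le (Θ : ContractiveAnalytic E F) {z : ℂ}
    (hz : z ∈ Metric.ball (0 : ℂ) 1) (e : E) : ‖Θ.toFun z e‖ ≤ ‖e‖ := by
  simpa using (Θ.toFun z).le_of_opNorm_le (Θ.contractive z hz) e

theorem HasBoundaryValue.norm_le {Θ : ContractiveAnalytic E F} {t : Torus} {A : E →L[ℂ] F}
    (hA : Θ.HasBoundaryValue t A) : ‖A‖ ≤ 1 := by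
  refine ContinuousLinearMap.opNorm_le_bound _ zero_le_one fun e => ?_
  rw [one_mul]
  refine le_of_tendsto (hA e).norm ?_
  filter_upwards [Ioo_mem_nhdsLT (zero_lt_one (α := ℝ))] with r hr
  exact Θ.norm_apply_le (norm_mul_toCircle_lt_one hr.1.le hr.2 t) e

theorem ContractiveAnalytic.norm_boundary_le (Θ : ContractiveAnalytic E F) (t : Torus) :
    ‖Θ.boundary t‖ ≤ 1 := by
  unfold ContractiveAnalytic.boundary
  split_ifs with h
  · exact HasBoundaryValue.norm_le h.choose_spec
  · simp

theorem HasBoundaryValue.boundary_eq {Θ : ContractiveAnalytic E F} {t : Torus} {A : E →L[ℂ] F}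
    (hA : Θ.HasBoundaryValue t A) : Θ.boundary t = A := by
  have h : ∃ A, Θ.HasBoundaryValue t A := ⟨A, hA⟩
  unfold ContractiveAnalytic.boundary
  rw [dif_pos h]
  exact HasBoundaryValue.unique h.choose_spec hA

/-- Pointwise convergence on a dense set gives a boundary value. -/
theorem exists_hasBoundaryValue [CompleteSpace F] (Θ : ContractiveAnalytic E F) (t : Torus)
    {D : Set E} (hD : Dense D)
    (h : ∀ d ∈ D, ∃ y : F, Tendsto (fun r : ℝ => Θ.toFun ((r : ℂ) * (toCircle t : ℂ)) d)
      (𝓝[<] 1) (𝓝 y)) : ∃ A, Θ.HasBoundaryValue t A := by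
  have hall : ∀ e, ∃ y : F, Tendsto (fun r : ℝ => Θ.toFun ((r : ℂ) * (toCircle t : ℂ)) e)
      (𝓝[<] 1) (𝓝 y) := by
    intro e
    rw [← cauchy_map_iff_exists_tendsto, Metric.cauchy_iff]
    refine ⟨inferInstance, fun ε hε => ?_⟩
    -- Contractivity makes the approximation of e by d uniform in r: eventually all values at e lie
    -- within ε/2 of the limit y at d, which is the Cauchy property.
    obtain ⟨d, hd, hed⟩ := hD.exists_dist_lt e (show 0 < ε / 4 by positivity)
    obtain ⟨y, hy⟩ := h d hd
    have hev := (Metric.tendsto_nhds.mp hy (ε / 4) (by positivity)).and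
      (Ioo_mem_nhdsLT (zero_lt_one (α := ℝ)))
    have hclose : ∀ r : ℝ, dist (Θ.toFun ((r : ℂ) * (toCircle t : ℂ)) d) y < ε / 4 ∧
        r ∈ Set.Ioo (0 : ℝ) 1 → dist (Θ.toFun ((r : ℂ) * (toCircle t : ℂ)) e) y < ε / 2 := by
      rintro r ⟨h1, h2⟩
      have h3 : dist (Θ.toFun ((r : ℂ) * (toCircle t : ℂ)) e)
          (Θ.toFun ((r : ℂ) * (toCircle t : ℂ)) d) ≤ dist e d := by
        rw [dist_eq_norm, dist_eq_norm, ← map_sub]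
        exact Θ.norm_apply_le (norm_mul_toCircle_lt_one h2.1.le h2.2 t) _
      linarith [dist_triangle (Θ.toFun ((r : ℂ) * (toCircle t : ℂ)) e)
        (Θ.toFun ((r : ℂ) * (toCircle t : ℂ)) d) y]
    refine ⟨_, image_mem_map hev, ?_⟩
    rintro _ ⟨r, hr, rfl⟩ _ ⟨s, hs, rfl⟩
    linarith [dist_triangle_right (Θ.toFun ((r : ℂ) * (toCircle t : ℂ)) e)
      (Θ.toFun ((s : ℂ) * (toCircle t : ℂ)) e) y, hclose r hr, hclose s hs]
  choose L hL using hall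
  refine ⟨LinearMap.mkContinuous
    { toFun := L
      map_add' := fun x y => tendsto_nhds_unique (hL (x + y)) (by
        simpa only [map_add] using (hL x).add (hL y))
      map_smul' := fun a x => tendsto_nhds_unique (hL (a • x)) (by
        simpa only [map_smul, RingHom.id_apply] using (hL x).const_smul a) } 1 fun e => ?_, fun e => hL e⟩
  rw [one_mul]
  refine le_of_tendsto (hL e).norm ?_
  filter_upwards [Ioo_mem_nhdsLT (zero_lt_one (α := ℝ))] with r hr
  exact Θ.norm_apply_le (norm_mul_toCircle_lt_one hr.1.le hr.2 t) e

/-- For a fixed vector `e`, the function `Θ(z) e` has almost everywhere a radial limit, whose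
Fourier coefficients are the coefficients of the power series. -/
theorem ContractiveAnalytic.exists_hardy_ae_tendsto_apply [CompleteSpace F]
    (Θ : ContractiveAnalytic E F) {c : ℕ → (E →L[ℂ] F)}
    (hc : ∀ z ∈ Metric.ball (0 : ℂ) 1, ∀ e : E, HasSum (fun n => z ^ n • c n e) (Θ.toFun z e))
    (e : E) :
    ∃ g ∈ hardy F, (∀ n : ℕ, fourierCoeff (g : Torus → F) n = c n e) ∧
      ∀ᵐ t ∂(haarAddCircle : Measure Torus),
        Tendsto (fun r : ℝ => Θ.toFun ((r : ℂ) * (toCircle t : ℂ)) e) (𝓝[<] 1) (𝓝 (g t)) :=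
  exists_hardy_ae_tendsto (f := fun z => Θ.toFun z e) (c := fun n => c n e) (C := ‖e‖)
    (fun z hz => hc z hz e) fun _ hz => Θ.norm_apply_le hz e

theorem ContractiveAnalytic.ae_hasBoundaryValue [CompleteSpace F]
    [TopologicalSpace.SeparableSpace E] (Θ : ContractiveAnalytic E F) :
    ∀ᵐ t ∂(haarAddCircle : Measure Torus), Θ.HasBoundaryValue t (Θ.boundary t) := by
  obtain ⟨c, hc⟩ := Θ.powerSeries
  have h : ∀ n : ℕ, ∀ᵐ t ∂(haarAddCircle : Measure Torus), ∃ y : F,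
      Tendsto (fun r : ℝ => Θ.toFun ((r : ℂ) * (toCircle t : ℂ)) (TopologicalSpace.denseSeq E n))
        (𝓝[<] 1) (𝓝 y) := by
    intro n
    obtain ⟨g, -, -, hg⟩ := Θ.exists_hardy_ae_tendsto_apply hc (TopologicalSpace.denseSeq E n)
    filter_upwards [hg] with t ht using ⟨_, ht⟩
  filter_upwards [ae_all_iff.mpr h] with t ht
  obtain ⟨A, hA⟩ := exists_hasBoundaryValue Θ t (TopologicalSpace.denseRange_denseSeq E) (by
    rintro _ ⟨n, rfl⟩
    exact ht n)
  rwa [HasBoundaryValue.boundary_eq hA]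

/-- For fixed e the dilation is a uniform limit of trigonometric polynomials in t; in e it is
1-Lipschitz uniformly in t. Joint continuity is what allows insertion of a measurable v(t) in place
of e. -/
theorem ContractiveAnalytic.continuous_dilation [CompleteSpace F] (Θ : ContractiveAnalytic E F)
    {r : ℝ} (hr : 0 ≤ r) (hr1 : r < 1) :
    Continuous fun p : E × Torus => Θ.toFun ((r : ℂ) * (toCircle p.2 : ℂ)) p.1 := by
  obtain ⟨c, hc⟩ := Θ.powerSeries
  refine continuous_prod_of_continuous_lipschitzWith _ 1 (fun e => ?_) fun t => ?_
  · obtain ⟨g, hg, -⟩ := hasSum_monomialC (f := fun z => Θ.toFun z e) (c := fun n => c n e)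
      (fun z hz => hc z hz e) hr hr1
    exact g.continuous.congr hg
  · refine LipschitzWith.of_dist_le_mul fun x y => ?_
    rw [dist_eq_norm, dist_eq_norm, ← map_sub, NNReal.coe_one, one_mul]
    exact Θ.norm_apply_le (norm_mul_toCircle_lt_one hr hr1 t) _

theorem ContractiveAnalytic.aestronglyMeasurable_boundary_apply [CompleteSpace F]
    [TopologicalSpace.SeparableSpace E] (Θ : ContractiveAnalytic E F) {v : Torus → E}
    (hv : AEStronglyMeasurable v (haarAddCircle : Measure Torus)) :
    AEStronglyMeasurable (fun t => Θ.boundary t (v t)) (haarAddCircle : Measure Torus) := by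
  obtain ⟨u, -, hu, hlim⟩ := exists_seq_strictMono_tendsto' (zero_lt_one (α := ℝ))
  have hlim' : Tendsto u atTop (𝓝[<] 1) :=
    tendsto_nhdsWithin_iff.mpr ⟨hlim, Eventually.of_forall fun n => (hu n).2⟩
  refine aestronglyMeasurable_of_tendsto_ae atTop
    (f := fun n t => Θ.toFun ((u n : ℂ) * (toCircle t : ℂ)) (v t)) (fun n => ?_) ?_
  · exact (Θ.continuous_dilation (hu n).1.le (hu n).2).comp_aestronglyMeasurable₂
      (g := fun e t => Θ.toFun ((u n : ℂ) * (toCircle t : ℂ)) e) hv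
      continuous_id.aestronglyMeasurable
  · filter_upwards [Θ.ae_hasBoundaryValue] with t ht
    exact (ht (v t)).comp hlim'

/-- This rules out the default value 0 in the definition of `mulOp`. -/
theorem ContractiveAnalytic.exists_isMulOp [CompleteSpace F]
    [TopologicalSpace.SeparableSpace E] (Θ : ContractiveAnalytic E F) :
    ∃ M : LTwo E →L[ℂ] LTwo F, Θ.IsMulOp M := by
  have hle : ∀ (v : LTwo E) (t : Torus), ‖Θ.boundary t (v t)‖ ≤ ‖v t‖ := fun v t => by
    simpa using (Θ.boundary t).le_of_opNorm_le (Θ.norm_boundary_le t) (v t)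
  have hmem : ∀ v : LTwo E, MemLp (fun t => Θ.boundary t (v t)) 2
      (haarAddCircle : Measure Torus) := fun v =>
    (Lp.memLp v).of_le (Θ.aestronglyMeasurable_boundary_apply (Lp.memLp v).aestronglyMeasurable)
      (Eventually.of_forall (hle v))
  refine ⟨LinearMap.mkContinuous
    { toFun := fun v => (hmem v).toLp _
      map_add' := fun v w => ?_
      map_smul' := fun a v => ?_ } 1 fun v => ?_, fun v => (hmem v).coeFn_toLp⟩
  · rw [← MemLp.toLp_add]
    refine MemLp.toLp_congr _ _ ?_
    filter_upwards [Lp.coeFn_add v w] with t ht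
    rw [ht, Pi.add_apply, map_add]
    rfl
  · rw [RingHom.id_apply, ← MemLp.toLp_const_smul]
    refine MemLp.toLp_congr _ _ ?_
    filter_upwards [Lp.coeFn_smul a v] with t ht
    rw [ht, Pi.smul_apply, Pi.smul_apply, map_smul]
  · rw [one_mul]
    refine Lp.norm_le_norm_of_ae_le ?_
    filter_upwards [(hmem v).coeFn_toLp] with t ht
    have : ((hmem v).toLp _ : LTwo F) t = Θ.boundary t (v t) := ht
    change ‖((hmem v).toLp _ : LTwo F) t‖ ≤ _
    rw [this]
    exact hle v t

theorem ContractiveAnalytic.isMulOp_mulOp [CompleteSpace F]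
    [TopologicalSpace.SeparableSpace E] (Θ : ContractiveAnalytic E F) : Θ.IsMulOp Θ.mulOp := by
  have h := Θ.exists_isMulOp
  unfold ContractiveAnalytic.mulOp
  rw [dif_pos h]
  exact h.choose_spec

variable [CompleteSpace F] [TopologicalSpace.SeparableSpace E]

theorem ContractiveAnalytic.norm_mulOp_le (Θ : ContractiveAnalytic E F) : ‖Θ.mulOp‖ ≤ 1 := by
  refine ContinuousLinearMap.opNorm_le_bound _ zero_le_one fun v => ?_
  rw [one_mul]
  refine Lp.norm_le_norm_of_ae_le ?_
  filter_upwards [Θ.isMulOp_mulOp v] with t ht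
  rw [ht]
  simpa using (Θ.boundary t).le_of_opNorm_le (Θ.norm_boundary_le t) (v t)

theorem ContractiveAnalytic.mulOp_fourierMul (Θ : ContractiveAnalytic E F) (n : ℤ) (v : LTwo E) :
    Θ.mulOp (fourierMul n v) = fourierMul n (Θ.mulOp v) := by
  refine Lp.ext ?_
  filter_upwards [Θ.isMulOp_mulOp (fourierMul n v), Θ.isMulOp_mulOp v, coeFn_fourierMul n v,
    coeFn_fourierMul n (Θ.mulOp v)] with t h1 h2 h3 h4
  rw [h1, h3, h4, h2, map_smul]

theorem ContractiveAnalytic.mulOp_monomial_zero (Θ : ContractiveAnalytic E F)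
    {c : ℕ → (E →L[ℂ] F)}
    (hc : ∀ z ∈ Metric.ball (0 : ℂ) 1, ∀ e : E, HasSum (fun n => z ^ n • c n e) (Θ.toFun z e))
    (e : E) : Θ.mulOp (monomial 0 e) ∈ hardy F ∧
      ∀ n : ℕ, fourierCoeff (Θ.mulOp (monomial 0 e) : Torus → F) n = c n e := by
  obtain ⟨g, hg, hgc, hlim⟩ := Θ.exists_hardy_ae_tendsto_apply hc e
  have h : Θ.mulOp (monomial 0 e) = g := by
    refine Lp.ext ?_
    filter_upwards [Θ.isMulOp_mulOp (monomial 0 e), coeFn_monomial 0 e, hlim,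
      Θ.ae_hasBoundaryValue] with t h1 h2 h3 h4
    rw [h1, h2, fourier_zero, one_smul]
    exact tendsto_nhds_unique (h4 e) h3
  rw [h]
  exact ⟨hg, hgc⟩

theorem mulOp_apply_ae_of_eq_const {Θ : ContractiveAnalytic E F} {U : E →ₗᵢ[ℂ] F}
    (h : ∀ z ∈ Metric.ball (0 : ℂ) 1, ∀ e : E, Θ.toFun z e = U e) (v : LTwo E) :
    ∀ᵐ t ∂(haarAddCircle : Measure Torus), Θ.mulOp v t = U (v t) := by
  filter_upwards [Θ.isMulOp_mulOp v] with t ht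
  have hb : Θ.HasBoundaryValue t U.toContinuousLinearMap := by
    intro e
    refine tendsto_const_nhds.congr' ?_
    filter_upwards [Ioo_mem_nhdsLT (zero_lt_one (α := ℝ))] with r hr
    exact (h _ (norm_mul_toCircle_lt_one hr.1.le hr.2 t) e).symm
  rw [ht, HasBoundaryValue.boundary_eq hb]
  rfl

/-- By density it suffices to treat monomials, and commutation with e^{int} reduces these to
constants, whose images are boundary functions of Θ(z)e. -/
theorem ContractiveAnalytic.mulOp_mem_hardy [CompleteSpace E] (Θ : ContractiveAnalytic E F)
    {u : LTwo E} (hu : u ∈ hardy E) : Θ.mulOp u ∈ hardy F := by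
  obtain ⟨c, hc⟩ := Θ.powerSeries
  refine hardy_le_of_monomial_mem ((hardy F).comap Θ.mulOp.toLinearMap)
    (isClosed_hardy.preimage Θ.mulOp.continuous) (fun n hn y => ?_) hu
  change Θ.mulOp (monomial n y) ∈ hardy F
  rw [← add_zero n, ← fourierMul_monomial, Θ.mulOp_fourierMul]
  exact fourierMul_mem_hardy hn (Θ.mulOp_monomial_zero hc y).1

end MulOp

/-! ### Vectors on which a contraction is isometric. -/

section Isometries

variable {H K : Type*} [NormedAddCommGroup H] [InnerProductSpace ℂ H] [CompleteSpace H]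
  [NormedAddCommGroup K] [InnerProductSpace ℂ K] [CompleteSpace K]

/-- `A^* A x = x` for every vector `x` on which the contraction `A` preserves the norm. -/
theorem adjoint_apply_apply_of_norm_eq (A : H →L[ℂ] K) (hA : ‖A‖ ≤ 1) {x : H}
    (hx : ‖A x‖ = ‖x‖) : ContinuousLinearMap.adjoint A (A x) = x := by
  have h1 : ‖ContinuousLinearMap.adjoint A (A x)‖ ≤ ‖x‖ := by
    have := (ContinuousLinearMap.adjoint A).le_of_opNorm_le
      ((ContinuousLinearMap.adjoint.norm_map A).trans_le hA) (A x)
    rwa [one_mul, hx] at this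
  have h2 : RCLike.re (inner ℂ (ContinuousLinearMap.adjoint A (A x)) x) = ‖x‖ ^ 2 := by
    rw [ContinuousLinearMap.adjoint_inner_left, inner_self_eq_norm_sq (𝕜 := ℂ), hx]
  have h3 := norm_sub_sq (𝕜 := ℂ) (ContinuousLinearMap.adjoint A (A x)) x
  rw [h2] at h3
  have h4 := pow_le_pow_left₀ (norm_nonneg _) h1 2
  have h5 : ‖ContinuousLinearMap.adjoint A (A x) - x‖ ^ 2 = 0 :=
    le_antisymm (by linarith) (sq_nonneg _)
  rw [← sub_eq_zero, ← norm_eq_zero]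
  exact pow_eq_zero_iff two_ne_zero |>.mp h5

theorem norm_apply_eq_of_defect_eq_zero (A : H →L[ℂ] K) (hA : ‖A‖ ≤ 1) {x : H}
    (hx : defect A x = 0) : ‖A x‖ = ‖x‖ := by
  have h := norm_defect_sq A hA x
  rw [hx, norm_zero] at h
  exact (sq_eq_sq₀ (norm_nonneg _) (norm_nonneg _)).mp (by linarith)

theorem coe_defectTo (A : H →L[ℂ] K) (x : H) : (defectTo A x : H) = defect A x := rfl

theorem defectTo_eq_zero_of_isometry (A : H →L[ℂ] K) (hA : ∀ x, ‖A x‖ = ‖x‖) (x : H) :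
    defectTo A x = 0 := by
  have hA1 : ‖A‖ ≤ 1 :=
    ContinuousLinearMap.opNorm_le_bound _ zero_le_one fun x => by rw [hA, one_mul]
  have h := norm_defect_sq A hA1 x
  rw [hA, sub_self] at h
  refine Subtype.ext ?_
  rw [coe_defectTo]
  exact norm_eq_zero.mp (pow_eq_zero_iff two_ne_zero |>.mp h)

theorem defectSpace_eq_zero_of_isometry (A : H →L[ℂ] K) (hA : ∀ x, ‖A x‖ = ‖x‖)
    (v : defectSpace A) : v = 0 := by
  have h := denseRange_defectTo A v
  have h2 : Set.range (defectTo A) ⊆ {0} := by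
    rintro _ ⟨x, rfl⟩
    exact defectTo_eq_zero_of_isometry A hA x
  simpa using closure_mono h2 h

end Isometries

/-! ### Unitary constants characterized by surjectivity on Hardy spaces. -/

section UnitaryConstant

open AddCircle

variable {E F : Type*} [NormedAddCommGroup E] [InnerProductSpace ℂ E] [CompleteSpace E]
  [TopologicalSpace.SeparableSpace E] [NormedAddCommGroup F] [InnerProductSpace ℂ F]
  [CompleteSpace F]

/-- Multiplication by e^{int} is unitary, and `mulOp` commutes with it and with its inverse. -/
theorem adjoint_mulOp_fourierMul (Θ : ContractiveAnalytic E F) (n : ℤ) (g : LTwo F) :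
    ContinuousLinearMap.adjoint Θ.mulOp (fourierMul n g)
      = fourierMul n (ContinuousLinearMap.adjoint Θ.mulOp g) := by
  refine ext_inner_right ℂ fun h => ?_
  have hh : h = fourierMul n (fourierMul (-n) h) := by
    rw [fourierMul_fourierMul, add_neg_cancel, fourierMul_zero]
  conv_rhs => rw [hh]
  rw [LinearIsometry.inner_map_map, ContinuousLinearMap.adjoint_inner_left,
    ContinuousLinearMap.adjoint_inner_left, Θ.mulOp_fourierMul,
    ← (fourierMul n).inner_map_map g, fourierMul_fourierMul, add_neg_cancel, fourierMul_zero]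

/-- `(Θ, Δ_Θ)` maps `H²(E)` onto `H²(F) ⊕ closure (Δ_Θ L²(E))`. -/
def HardySurjective (Θ : ContractiveAnalytic E F) : Prop :=
  ∀ u' ∈ hardy F, ∀ v : defectSpace Θ.mulOp,
    ∃ u ∈ hardy E, Θ.mulOp u = u' ∧ defectTo Θ.mulOp u = v

/-- A preimage u ∈ H² of 0 ⊕ Δf equals (I - Θ^*Θ)f. The range of I - Θ^*Θ thus lies in H² and is
invariant under all e^{int}, so it is zero. -/
theorem HardySurjective.adjoint_apply_apply {Θ : ContractiveAnalytic E F}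
    (hΘ : HardySurjective Θ) (f : LTwo E) :
    ContinuousLinearMap.adjoint Θ.mulOp (Θ.mulOp f) = f := by
  have key : ∀ f : LTwo E, f - ContinuousLinearMap.adjoint Θ.mulOp (Θ.mulOp f) ∈ hardy E := by
    intro f
    obtain ⟨u, hu, hu1, hu2⟩ := hΘ 0 (zero_mem _) (defectTo Θ.mulOp f)
    have h1 : defect Θ.mulOp (u - f) = 0 := by
      rw [map_sub, sub_eq_zero]
      exact congrArg Subtype.val hu2
    have h2 := adjoint_apply_apply_of_norm_eq Θ.mulOp Θ.norm_mulOp_le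
      (norm_apply_eq_of_defect_eq_zero Θ.mulOp Θ.norm_mulOp_le h1)
    rw [map_sub, hu1, zero_sub, map_neg] at h2
    have h3 : f - ContinuousLinearMap.adjoint Θ.mulOp (Θ.mulOp f) = u := by
      rw [sub_eq_add_neg, h2, add_sub_cancel]
    rwa [h3]
  symm
  rw [← sub_eq_zero]
  refine eq_zero_of_forall_fourierMul_mem_hardy _ fun n => ?_
  rw [map_sub, ← adjoint_mulOp_fourierMul, ← Θ.mulOp_fourierMul]
  exact key _

theorem HardySurjective.inner_mulOp_mulOp {Θ : ContractiveAnalytic E F}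
    (hΘ : HardySurjective Θ) (f g : LTwo E) :
    inner ℂ (Θ.mulOp f) (Θ.mulOp g) = inner ℂ f g := by
  rw [← ContinuousLinearMap.adjoint_inner_right, hΘ.adjoint_apply_apply]

theorem HardySurjective.norm_mulOp {Θ : ContractiveAnalytic E F}
    (hΘ : HardySurjective Θ) (f : LTwo E) : ‖Θ.mulOp f‖ = ‖f‖ := by
  rw [@norm_eq_sqrt_re_inner ℂ, @norm_eq_sqrt_re_inner ℂ _ _ _ _ f, hΘ.inner_mulOp_mulOp]

/-- An isometric Θ with ΘH²(E) = H²(F) respects H² ⊖ e^{it}H², hence sends constants onto constants;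
the coefficient c_0 is then the unitary operator sought. -/
theorem HardySurjective.isUnitaryConstant [TopologicalSpace.SeparableSpace F]
    {Θ : ContractiveAnalytic E F} (hΘ : HardySurjective Θ) : Θ.IsUnitaryConstant := by
  obtain ⟨c, hc⟩ := Θ.powerSeries
  have hzero : ∀ (e : E) (n : ℕ), n ≠ 0 → c n e = 0 := by
    intro e n hn
    obtain ⟨m, rfl⟩ := Nat.exists_eq_succ_of_ne_zero hn
    rw [← (Θ.mulOp_monomial_zero hc e).2]
    refine ext_inner_left ℂ fun y => ?_
    rw [inner_zero_right, ← inner_monomial_left]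
    obtain ⟨u, hu, hu1, -⟩ := hΘ (monomial (m : ℤ) y)
      (monomial_mem_hardy (Int.natCast_nonneg m) y) 0
    -- A monomial of degree m + 1 is Θ applied to e^{it}u with u ∈ H². Since e^{it}u is orthogonal
    -- to the constant e and Θ is isometric, the coefficient c_{m+1} e pairs to 0 with y.
    have h1 : monomial ((m.succ : ℕ) : ℤ) y = Θ.mulOp (fourierMul 1 u) := by
      rw [Θ.mulOp_fourierMul, hu1, fourierMul_monomial]
      congr 1
      push_cast
      ring
    rw [h1, hΘ.inner_mulOp_mulOp, ← inner_conj_symm, inner_monomial_left,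
      fourierCoeff_fourierMul, hu _ (by norm_num), inner_zero_right, map_zero]
  have hmono : ∀ e : E, Θ.mulOp (monomial 0 e) = monomial 0 (c 0 e) := by
    intro e
    refine ext_fourierCoeff fun n => ?_
    rw [fourierCoeff_monomial]
    rcases lt_trichotomy n 0 with hn | rfl | hn
    · rw [(Θ.mulOp_monomial_zero hc e).1 n hn, if_neg hn.ne']
    · rw [if_pos rfl]
      exact (Θ.mulOp_monomial_zero hc e).2 0
    · lift n to ℕ using hn.le
      rw [(Θ.mulOp_monomial_zero hc e).2 n, hzero e n (by omega), if_neg hn.ne]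
  have hval : ∀ z ∈ Metric.ball (0 : ℂ) 1, ∀ e : E, Θ.toFun z e = c 0 e := by
    intro z hz e
    refine (hc z hz e).unique ?_
    have := hasSum_single (f := fun n : ℕ => z ^ n • c n e) 0 (fun n hn => by
      rw [hzero e n hn, smul_zero])
    simpa using this
  have hnorm : ∀ e : E, ‖c 0 e‖ = ‖e‖ := by
    intro e
    rw [← norm_monomial 0 (c 0 e), ← hmono, hΘ.norm_mulOp, norm_monomial]
  have hsurj : Function.Surjective (c 0) := by
    intro y
    obtain ⟨u, hu, hu1, -⟩ := hΘ (monomial 0 y) (monomial_mem_hardy le_rfl y) 0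
    -- For n > 0, Θ sends e^{int}e to a monomial of degree n, which is orthogonal to the constant y
    -- = Θu; so u has only its zeroth coefficient.
    have hu2 : u = monomial 0 (fourierCoeff (u : Torus → E) 0) := by
      refine ext_fourierCoeff fun n => ?_
      rw [fourierCoeff_monomial]
      rcases lt_trichotomy n 0 with hn | rfl | hn
      · rw [hu n hn, if_neg hn.ne']
      · rw [if_pos rfl]
      · rw [if_neg hn.ne]
        refine ext_inner_left ℂ fun e => ?_
        have h1 : Θ.mulOp (monomial n e) = monomial n (c 0 e) := by
          have := fourierMul_monomial n 0 e
          rw [add_zero] at this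
          rw [← this, Θ.mulOp_fourierMul, hmono, fourierMul_monomial, add_zero]
        rw [inner_zero_right, ← inner_monomial_left, ← hΘ.inner_mulOp_mulOp, hu1, h1,
          inner_monomial_left, fourierCoeff_monomial, if_neg hn.ne, inner_zero_right]
    refine ⟨fourierCoeff (u : Torus → E) 0, (monomialIsometry (F := F) 0).injective ?_⟩
    rw [monomialIsometry_apply, ← hmono, ← hu2, hu1]
    rfl
  exact ⟨LinearIsometryEquiv.ofSurjective ⟨(c 0).toLinearMap, hnorm⟩ hsurj, hval⟩

/-- The constant function with value a linear isometry. -/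
noncomputable def ContractiveAnalytic.const (U : E →ₗᵢ[ℂ] F) : ContractiveAnalytic E F where
  toFun _ := U.toContinuousLinearMap
  powerSeries := by
    refine ⟨fun n => if n = 0 then U.toContinuousLinearMap else 0, fun z _ e => ?_⟩
    have := hasSum_single (f := fun n : ℕ => z ^ n •
      (if n = 0 then U.toContinuousLinearMap else 0 : E →L[ℂ] F) e) 0 (fun n hn => by simp [hn])
    simpa using this
  contractive _ _ := U.norm_toContinuousLinearMap_le

theorem ContractiveAnalytic.IsUnitaryConstant.hardySurjective [TopologicalSpace.SeparableSpace F]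
    {Θ : ContractiveAnalytic E F} (hΘ : Θ.IsUnitaryConstant) : HardySurjective Θ := by
  obtain ⟨U, hU⟩ := hΘ
  have hM := mulOp_apply_ae_of_eq_const (U := U.toLinearIsometry) hU
  have hiso : ∀ f, ‖Θ.mulOp f‖ = ‖f‖ := by
    intro f
    rw [Lp.norm_def, Lp.norm_def]
    congr 1
    refine eLpNorm_congr_norm_ae ?_
    filter_upwards [hM f] with t ht
    rw [ht]
    exact U.norm_map _
  intro u' hu' v
  set Θ' := ContractiveAnalytic.const U.symm.toLinearIsometry with hΘ'
  refine ⟨Θ'.mulOp u', Θ'.mulOp_mem_hardy hu', ?_, ?_⟩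
  · refine Lp.ext ?_
    filter_upwards [hM (Θ'.mulOp u'), mulOp_apply_ae_of_eq_const
      (Θ := Θ') (U := U.symm.toLinearIsometry) (fun z _ e => rfl) u'] with t h1 h2
    rw [h1, h2]
    exact U.apply_symm_apply _
  · rw [defectTo_eq_zero_of_isometry _ hiso, defectSpace_eq_zero_of_isometry _ hiso v]

end UnitaryConstant

/-! ### Products along a chain of contractions. -/

section Chains

variable {k : ℕ} {X : Fin (k + 1) → Type*} [∀ i, NormedAddCommGroup (X i)]

section

variable [∀ i, NormedSpace ℂ (X i)] (T : ∀ j : Fin k, X j.castSucc →L[ℂ] X j.succ)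

theorem chainProd_comp {h i j : Fin (k + 1)} (hhi : h ≤ i) (hij : i ≤ j) :
    (chainProd T i j hij).comp (chainProd T h i hhi) = chainProd T h j (hhi.trans hij) := by
  induction j using Fin.induction with
  | zero =>
    obtain rfl : i = 0 := Fin.le_zero_iff.mp hij
    rw [chainProd_self, ContinuousLinearMap.id_comp]
  | succ j ih =>
    rcases hij.eq_or_lt with rfl | hlt
    · rw [chainProd_self, ContinuousLinearMap.id_comp]
    · have hle : i ≤ j.castSucc := Fin.le_castSucc_iff.mpr hlt
      rw [chainProd_succ T i j hle, chainProd_succ T h j (hhi.trans hle), ← ih hle,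
        ContinuousLinearMap.comp_assoc]

/-- The recursion defining `chainProd` adds factors at the target end; comparing S_i with S_{i+1}
requires splitting one off at the source end. -/
theorem chainProd_castSucc (i : Fin k) (j : Fin (k + 1)) (h : i.succ ≤ j) :
    chainProd T i.castSucc j ((Fin.castSucc_lt_succ).le.trans h)
      = (chainProd T i.succ j h).comp (T i) := by
  rw [← chainProd_comp T (Fin.castSucc_lt_succ (i := i)).le h, chainProd_succ T _ i le_rfl,
    chainProd_self, ContinuousLinearMap.comp_id]

end

variable [∀ i, InnerProductSpace ℂ (X i)] [∀ i, CompleteSpace (X i)]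
  (T : ∀ j : Fin k, X j.castSucc →L[ℂ] X j.succ)

/-- The map `u ↦ T_{k-1} ⋯ T_i u ⊕ D_{T_{k-1}} T_{k-2} ⋯ T_i u ⊕ ⋯ ⊕ D_{T_i} u` is injective. -/
theorem eq_zero_of_defectTo_chainProd_eq_zero (hT : ∀ j, ‖T j‖ ≤ 1) {i : Fin (k + 1)} {u : X i}
    (hd : ∀ (j : Fin k) (h : i ≤ j.castSucc), defectTo (T j) (chainProd T i j.castSucc h u) = 0)
    (hl : chainProd T i (Fin.last k) (Fin.le_last i) u = 0) : u = 0 := by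
  have key : ∀ (j : Fin (k + 1)) (h : i ≤ j), ‖chainProd T i j h u‖ = ‖u‖ := by
    intro j
    induction j using Fin.induction with
    | zero =>
      intro hij
      obtain rfl : i = 0 := Fin.le_zero_iff.mp hij
      rw [chainProd_self]
      rfl
    | succ j ih =>
      intro hij
      rcases hij.eq_or_lt with rfl | hlt
      · rw [chainProd_self]
        rfl
      · have hle : i ≤ j.castSucc := Fin.le_castSucc_iff.mpr hlt
        rw [chainProd_succ T i j hle, ← ih hle]
        exact norm_apply_eq_of_defect_eq_zero (T j) (hT j) (congrArg Subtype.val (hd j hle))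
  rw [← norm_eq_zero, ← key _ (Fin.le_last i), hl, norm_zero]

end Chains

/-! ### The subspaces S_i and M_i of the functional model. -/

section Model

open AddCircle

variable {k : ℕ} {E : Fin (k + 1) → Type*} [∀ i, NormedAddCommGroup (E i)]
  [∀ i, InnerProductSpace ℂ (E i)]

/-- Strong limits of products are products of strong limits here because the factors are uniformly
bounded by 1. -/
theorem tendsto_chainProd_apply (Φ : ∀ j : Fin k, ContractiveAnalytic (E j.castSucc) (E j.succ))
    {t : Torus} (ht : ∀ j, (Φ j).HasBoundaryValue t ((Φ j).boundary t)) (j : Fin (k + 1))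
    (e : E 0) :
    Tendsto (fun r : ℝ => chainProd (fun j => (Φ j).toFun ((r : ℂ) * (toCircle t : ℂ))) 0 j
      (Fin.zero_le _) e) (𝓝[<] 1)
      (𝓝 (chainProd (fun j => (Φ j).boundary t) 0 j (Fin.zero_le _) e)) := by
  induction j using Fin.induction with
  | zero =>
    simp only [chainProd_self]
    exact tendsto_const_nhds
  | succ j ih =>
    simp only [chainProd_succ _ _ j (Fin.zero_le _), ContinuousLinearMap.comp_apply]
    set y := chainProd (fun j => (Φ j).boundary t) 0 j.castSucc (Fin.zero_le _) e with hy
    have h1 := ht j y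
    rw [tendsto_iff_norm_sub_tendsto_zero] at ih h1 ⊢
    have h2 := ih.add h1
    rw [add_zero] at h2
    refine squeeze_zero' (Eventually.of_forall fun r => norm_nonneg _) ?_ h2
    filter_upwards [Ioo_mem_nhdsLT (zero_lt_one (α := ℝ))] with r hr
    refine (norm_sub_le_norm_sub_add_norm_sub _
      ((Φ j).toFun ((r : ℂ) * (toCircle t : ℂ)) y) _).trans (add_le_add_left ?_ _)
    rw [← map_sub]
    exact (Φ j).norm_apply_le (norm_mul_toCircle_lt_one hr.1.le hr.2 t) _

variable [∀ i, CompleteSpace (E i)] {Θ : ContractiveAnalytic (E 0) (E (Fin.last k))}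
  {Φ : ∀ j : Fin k, ContractiveAnalytic (E j.castSucc) (E j.succ)}

theorem IsRegularFactorization.adjoint_factorZ_factorZ (hreg : IsRegularFactorization Θ Φ)
    (x : defectSpace Θ.mulOp) :
    ContinuousLinearMap.adjoint (factorZ Θ Φ) (factorZ Θ Φ x) = x :=
  adjoint_apply_apply_of_norm_eq _
    (ContinuousLinearMap.opNorm_le_bound _ zero_le_one fun x => by rw [hreg.2.1, one_mul])
    (hreg.2.1 x)

/-- Surjectivity of Z, that is, regularity, enters here: every tuple w is some Zx, and Z^*Z = I. -/
theorem IsRegularFactorization.adjoint_factorZ_injective (hreg : IsRegularFactorization Θ Φ) :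
    Function.Injective (ContinuousLinearMap.adjoint (factorZ Θ Φ)) := by
  intro a b hab
  obtain ⟨x, rfl⟩ := hreg.2.2 a
  obtain ⟨y, rfl⟩ := hreg.2.2 b
  rw [hreg.adjoint_factorZ_factorZ, hreg.adjoint_factorZ_factorZ] at hab
  rw [hab]

/-- One u ∈ H²(E_i) realizes both u' = Φ_i u and the free component w_i = Δ_i u; the tuple w stays
the same. -/
theorem HardySurjective.preSubspace_succ_le {i : Fin k} (h : HardySurjective (Φ i)) :
    preSubspace Θ Φ i.succ ≤ preSubspace Θ Φ i.castSucc := by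
  rintro _ ⟨u', hu', w, hw, rfl⟩
  obtain ⟨u, hu, rfl, hu2⟩ := h u' hu' (w i)
  refine ⟨u, hu, w, fun j hj => ?_, ?_⟩
  · rcases (Fin.castSucc_le_castSucc_iff.mp hj).eq_or_lt with rfl | hlt
    · rw [← hu2]
      unfold mulProd
      rw [chainProd_self]
      rfl
    · have hle : i.succ ≤ j.castSucc := Fin.succ_le_castSucc_iff.mpr hlt
      rw [hw j hle]
      exact congrArg (fun A => defectTo (mulOps Φ j) (A u))
        (chainProd_castSucc (X := fun i => LTwo (E i)) (mulOps Φ) i _ hle).symm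
  · exact congrArg (fun A => (WithLp.toLp 2 (A u, _) : ModelAmbient Θ))
      (chainProd_castSucc (X := fun i => LTwo (E i)) (mulOps Φ) i _ (Fin.le_last _)).symm

variable [∀ i, TopologicalSpace.SeparableSpace (E i)]

theorem norm_mulOps_le (Φ : ∀ j : Fin k, ContractiveAnalytic (E j.castSucc) (E j.succ))
    (j : Fin k) : ‖mulOps Φ j‖ ≤ 1 :=
  (Φ j).norm_mulOp_le

theorem mulProd_mem_hardy (Φ : ∀ j : Fin k, ContractiveAnalytic (E j.castSucc) (E j.succ))
    (j : Fin (k + 1)) {u : LTwo (E 0)} (hu : u ∈ hardy (E 0)) :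
    mulProd Φ 0 j (Fin.zero_le _) u ∈ hardy (E j) := by
  unfold mulProd
  induction j using Fin.induction with
  | zero => rwa [chainProd_self]
  | succ j ih =>
    rw [chainProd_succ _ _ j (Fin.zero_le _)]
    exact (Φ j).mulOp_mem_hardy ih

theorem mulProd_apply_ae (Φ : ∀ j : Fin k, ContractiveAnalytic (E j.castSucc) (E j.succ))
    (j : Fin (k + 1)) (u : LTwo (E 0)) :
    ∀ᵐ t ∂(haarAddCircle : Measure Torus), mulProd Φ 0 j (Fin.zero_le _) u t
      = chainProd (fun j => (Φ j).boundary t) 0 j (Fin.zero_le _) (u t) := by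
  unfold mulProd
  induction j using Fin.induction with
  | zero =>
    refine Eventually.of_forall fun t => ?_
    rw [chainProd_self, chainProd_self]
    rfl
  | succ j ih =>
    filter_upwards [ih, (Φ j).isMulOp_mulOp
      (chainProd (X := fun i => LTwo (E i)) (mulOps Φ) 0 j.castSucc (Fin.zero_le _) u)]
      with t h1 h2
    rw [chainProd_succ _ _ j (Fin.zero_le _), chainProd_succ _ _ j (Fin.zero_le _),
      ContinuousLinearMap.comp_apply, ContinuousLinearMap.comp_apply, ← h1, ← h2]
    rfl

/-- Multiplication by a product of analytic functions is the product of the multiplications. -/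
theorem mulOp_eq_mulProd (Θ : ContractiveAnalytic (E 0) (E (Fin.last k)))
    (Φ : ∀ j : Fin k, ContractiveAnalytic (E j.castSucc) (E j.succ))
    (h : ∀ z ∈ Metric.ball (0 : ℂ) 1,
      Θ.toFun z = chainProd (fun j => (Φ j).toFun z) 0 (Fin.last k) (Fin.zero_le _)) :
    Θ.mulOp = mulProd Φ 0 (Fin.last k) (Fin.zero_le _) := by
  refine Θ.isMulOp_mulOp.unique fun v => ?_
  have hall := ae_all_iff.mpr fun j => (Φ j).ae_hasBoundaryValue
  filter_upwards [mulProd_apply_ae Φ (Fin.last k) v, hall] with t h1 h2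
  have hb : Θ.HasBoundaryValue t
      (chainProd (fun j => (Φ j).boundary t) 0 (Fin.last k) (Fin.zero_le _)) := by
    intro e
    refine (tendsto_chainProd_apply Φ h2 (Fin.last k) e).congr' ?_
    filter_upwards [Ioo_mem_nhdsLT (zero_lt_one (α := ℝ))] with r hr
    rw [h _ (norm_mul_toCircle_lt_one hr.1.le hr.2 t)]
  rw [h1, HasBoundaryValue.boundary_eq hb]

/-- The map u ↦ Θu ⊕ Δ_Θ u is isometric on L², and H² is closed. -/
theorem completeSpace_graphSpace {E F : Type*} [NormedAddCommGroup E] [InnerProductSpace ℂ E]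
    [CompleteSpace E] [NormedAddCommGroup F] [InnerProductSpace ℂ F] [CompleteSpace F]
    [TopologicalSpace.SeparableSpace E] (Θ : ContractiveAnalytic E F) :
    CompleteSpace (graphSpace Θ) := by
  let V : LTwo E →ₗᵢ[ℂ] ModelAmbient Θ :=
    { toFun := fun u => WithLp.toLp 2 (Θ.mulOp u, defectTo Θ.mulOp u)
      map_add' := fun u v => by simp [← WithLp.toLp_add]
      map_smul' := fun c u => by simp [← WithLp.toLp_smul]
      norm_map' := fun u => by
        have h1 := norm_defect_sq Θ.mulOp Θ.norm_mulOp_le u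
        refine (sq_eq_sq₀ (norm_nonneg _) (norm_nonneg _)).mp ?_
        change ‖(WithLp.toLp 2 (Θ.mulOp u, defectTo Θ.mulOp u) : ModelAmbient Θ)‖ ^ 2 = _
        rw [WithLp.prod_norm_sq_eq_of_L2]
        change ‖Θ.mulOp u‖ ^ 2 + ‖defect Θ.mulOp u‖ ^ 2 = _
        linarith }
  have h : (graphSpace Θ : Set (ModelAmbient Θ)) = V '' (hardy E : Set (LTwo E)) := by
    ext x
    constructor
    · rintro ⟨u, hu, rfl⟩
      exact ⟨u, hu, rfl⟩
    · rintro ⟨u, hu, rfl⟩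
      exact ⟨u, hu, rfl⟩
  have hc : IsComplete (graphSpace Θ : Set (ModelAmbient Θ)) := by
    rw [h, LinearIsometry.isComplete_image_iff]
    exact isClosed_hardy.isComplete
  exact hc.completeSpace_coe

/-- The witnesses are Φ_{i-1}⋯Φ_0 u and the full defect tuple of u, which is Z(Δ_Θ u); then Z^*Z = I
returns Δ_Θ u. -/
theorem IsRegularFactorization.graphSpace_le_preSubspace (hreg : IsRegularFactorization Θ Φ)
    (i : Fin (k + 1)) : graphSpace Θ ≤ preSubspace Θ Φ i := by
  rintro _ ⟨u, hu, rfl⟩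
  have hA := mulOp_eq_mulProd Θ Φ hreg.1
  refine ⟨mulProd Φ 0 i (Fin.zero_le _) u, mulProd_mem_hardy Φ i hu,
    defectTuple (X := fun i => LTwo (E i)) (mulOps Φ) u, fun j h => ?_, ?_⟩
  · have := congrArg (fun A => A u)
      (chainProd_comp (X := fun i => LTwo (E i)) (mulOps Φ) (Fin.zero_le i) h)
    exact congrArg (defectTo (mulOps Φ j)) this.symm
  · have h1 := congrArg (fun A => A u)
      (chainProd_comp (X := fun i => LTwo (E i)) (mulOps Φ) (Fin.zero_le i) (Fin.le_last i))
    have h2 : factorZ Θ Φ (defectTo Θ.mulOp u)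
        = defectTuple (X := fun i => LTwo (E i)) (mulOps Φ) u :=
      canonicalZ_defectTo (X := fun i => LTwo (E i)) Θ.mulOp (mulOps Φ) (norm_mulOps_le Φ) hA u
    rw [← h2, hreg.adjoint_factorZ_factorZ]
    congr 2
    rw [hA]
    exact h1.symm

/-- Replacing u by Φ_i u keeps the same vector and merely forgets the constraint on the component i.
-/
theorem preSubspace_castSucc_le_succ (Θ : ContractiveAnalytic (E 0) (E (Fin.last k)))
    (Φ : ∀ j : Fin k, ContractiveAnalytic (E j.castSucc) (E j.succ)) (i : Fin k) :
    preSubspace Θ Φ i.castSucc ≤ preSubspace Θ Φ i.succ := by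
  rintro _ ⟨u, hu, w, hw, rfl⟩
  refine ⟨(Φ i).mulOp u, (Φ i).mulOp_mem_hardy hu, w, fun j h => ?_, ?_⟩
  · rw [hw j ((Fin.castSucc_lt_succ).le.trans h)]
    exact congrArg (fun A => defectTo (mulOps Φ j) (A u))
      (chainProd_castSucc (X := fun i => LTwo (E i)) (mulOps Φ) i _ h)
  · exact congrArg (fun A => (WithLp.toLp 2 (A u, _) : ModelAmbient Θ))
      (chainProd_castSucc (X := fun i => LTwo (E i)) (mulOps Φ) i _ (Fin.le_last _))

/-- Since G lies in both spaces and admits orthogonal projection, each space is recovered from its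
part orthogonal to G. -/
theorem IsRegularFactorization.invSubspace_eq_iff (hreg : IsRegularFactorization Θ Φ)
    (i : Fin k) : invSubspace Θ Φ i.castSucc = invSubspace Θ Φ i.succ ↔
      preSubspace Θ Φ i.succ ≤ preSubspace Θ Φ i.castSucc := by
  constructor
  · intro h x hx
    have := completeSpace_graphSpace Θ
    obtain ⟨g, hg, m, hm, rfl⟩ := (graphSpace Θ).exists_add_mem_mem_orthogonal x
    have hmS : m ∈ preSubspace Θ Φ i.succ := by
      have := sub_mem hx (hreg.graphSpace_le_preSubspace i.succ hg)
      rwa [add_sub_cancel_left] at this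
    have hmI : m ∈ invSubspace Θ Φ i.castSucc := h ▸ ⟨hmS, hm⟩
    exact add_mem (hreg.graphSpace_le_preSubspace _ hg) hmI.1
  · intro h
    unfold invSubspace
    rw [le_antisymm (preSubspace_castSucc_le_succ Θ Φ i) h]

theorem IsRegularFactorization.hardySurjective (hreg : IsRegularFactorization Θ Φ) {i : Fin k}
    (h : preSubspace Θ Φ i.succ ≤ preSubspace Θ Φ i.castSucc) : HardySurjective (Φ i) := by
  classical
  intro u' hu' v
  -- The test vector of S_{i+1} has the defect components of u' above i, the prescribed v at i and 0
  -- below i.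
  let w₀ : ∀ j : Fin k, defectSpace (mulOps Φ j) := fun j =>
    if hj : i.succ ≤ j.castSucc then
      defectTo (mulOps Φ j) (mulProd Φ i.succ j.castSucc hj u') else 0
  let w : DefectSum (X := fun i => LTwo (E i)) (mulOps Φ) :=
    WithLp.toLp 2 (Function.update w₀ i v)
  have hwi : w i = v := Function.update_self i v w₀
  have hw : ∀ (j : Fin k) (hj : i.succ ≤ j.castSucc),
      w j = defectTo (mulOps Φ j) (mulProd Φ i.succ j.castSucc hj u') := by
    intro j hj
    have hne : j ≠ i := (Fin.succ_le_castSucc_iff.mp hj).ne'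
    exact (Function.update_of_ne hne v w₀).trans (dif_pos hj)
  obtain ⟨u, hu, w', hw', heq⟩ := h ⟨u', hu', w, hw, rfl⟩
  have heq2 := congrArg WithLp.ofLp heq
  have h1 := congrArg Prod.fst heq2
  have h2 : w = w' := hreg.adjoint_factorZ_injective (congrArg Prod.snd heq2)
  refine ⟨u, hu, ?_, ?_⟩
  -- Φ_i u and u' share the final image and all defect components above i, so their difference is
  -- killed by an injective map.
  · rw [← sub_eq_zero]
    refine eq_zero_of_defectTo_chainProd_eq_zero (X := fun i => LTwo (E i)) (mulOps Φ)
      (norm_mulOps_le Φ) (i := i.succ) (fun j hj => ?_) ?_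
    · have h3 := hw' j ((Fin.castSucc_lt_succ).le.trans hj)
      rw [← h2, hw j hj] at h3
      have h4 := congrArg (fun A => defectTo (mulOps Φ j) (A u))
        (chainProd_castSucc (X := fun i => LTwo (E i)) (mulOps Φ) i _ hj)
      rw [map_sub, map_sub, sub_eq_zero]
      exact (h3.trans h4).symm
    · have h4 := congrArg (fun A => A u)
        (chainProd_castSucc (X := fun i => LTwo (E i)) (mulOps Φ) i _ (Fin.le_last _))
      rw [map_sub, sub_eq_zero]
      exact (h1.trans h4).symm
  · have h3 := hw' i le_rfl
    rw [← h2, hwi] at h3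
    unfold mulProd at h3
    rw [chainProd_self] at h3
    exact h3.symm

end Model

end KRegular

/-- With factors numbered from 0, `Φ i` is Θ_{i+1}, while `i.castSucc` and `i.succ` index M_i and
M_{i+1}. -/
theorem corollary3p7 {k : ℕ} (hk : 2 ≤ k) (E : Fin (k + 1) → Type*)
    [∀ i, NormedAddCommGroup (E i)] [∀ i, InnerProductSpace ℂ (E i)]
    [∀ i, CompleteSpace (E i)] [∀ i, TopologicalSpace.SeparableSpace (E i)]
    (Θ : KRegular.ContractiveAnalytic (E 0) (E (Fin.last k))) (hΘ : Θ.IsPure)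
    (Φ : ∀ j : Fin k, KRegular.ContractiveAnalytic (E j.castSucc) (E j.succ))
    (hreg : KRegular.IsRegularFactorization Θ Φ)
    (i : Fin k) (hi : 1 ≤ (i : ℕ)) (hi' : (i : ℕ) + 2 ≤ k) :
    KRegular.invSubspace Θ Φ i.castSucc = KRegular.invSubspace Θ Φ i.succ ↔
      (Φ i).IsUnitaryConstant :=
  (hreg.invSubspace_eq_iff i).trans
    ⟨fun h => (hreg.hardySurjective h).isUnitaryConstant,
      fun h => h.hardySurjective.preSubspace_succ_le⟩
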